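/- \textbf{Proposition.} $\mathsf{RCA}_0$ (the basic axioms of arithmetic, induction for $\Sigma^0_1$-formulas and comprehension for $\Delta^0_1$-formulas, with parameters) proves the following. Suppose every function identifier $f$ comes with a finite set $\mathrm{Var}(f)$ of parameters. A \emph{size-change graph} $G\colon f\to g$, with source $f$ and target $g$, is a set of edges $E\subseteq \mathrm{Var}(f)\times\{\downarrow,\Downarrow\}\times\mathrm{Var}(g)$ with at most one edge for any $x\in\mathrm{Var}(f)$ and $y\in\mathrm{Var}(g)$; edges are written $x\xrightarrow{\downarrow}y$ (\emph{strict} or \emph{decreasing}) and $x\xrightarrow{\Downarrow}y$ (\emph{non-strict}). The composition $G_0;G_1\colon f\to h$ of $G_0\colon f\to g$ and $G_1\colon g\to h$ has an edge from $x$ to $z$ iff for some $y\in\mathrm{Var}(g)$ there are edges from $x$ to $y$ in $G_0$ and from $y$ to $z$ in $G_1$; this edge is non-strict if for every such $y$ both edges are non-strict, and strict otherwise. $G$ is \emph{idempotent} if $G;G=G$. For a finite set $\mathcal G$ of size-change graphs, $\mathrm{cl}(\mathcal G)$ is the smallest set of size-change graphs that contains $\mathcal G$ and is closed under composition. A \emph{multipath}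 over $\mathcal G$ is an infinite sequence $G_0,G_1,G_2,\dots$ of elements of $\mathcal G$ such that the target of $G_i$ is the source of $G_{i+1}$ for all $i$. It has \emph{infinite descent} if for some $t$ there is an infinite sequence $x_0,x_1,x_2,\dots$ such that for every $i$ there is an edge from $x_i$ to $x_{i+1}$ in $G_{t+i}$, and this edge is strict for infinitely many $i$. Let $\mathcal G$ be a finite set of size-change graphs. If every multipath over $\mathcal G$ has infinite descent, then every idempotent $G\in\mathrm{cl}(\mathcal G)$ has an arc $x\xrightarrow{\downarrow}x$ for some parameter $x$. -/

import Mathlib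

universe u

namespace SOA

/-! ### Syntax of second-order arithmetic -/

/-- Number terms of the language of second-order arithmetic, with free number variables `Fin n`. -/
inductive Term (n : ℕ) : Type
  | var (i : Fin n) : Term n
  | zero : Term n
  | one : Term n
  | add (s t : Term n) : Term n
  | mul (s t : Term n) : Term n

/-- Formulas of the (two-sorted) language of second-order arithmetic, with free number variables
`Fin n` and free set variables `Fin m`. A quantifier binds the last variable of its body. -/
inductive Fml : ℕ → ℕ → Type
  | eq {n m : ℕ} (s t : Term n) : Fml n m
  | lt {n m : ℕ} (s t : Term n) : Fml n m
  | mem {n m : ℕ} (t : Term n) (X : Fin m) : Fml n m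
  | neg {n m : ℕ} (φ : Fml n m) : Fml n m
  | and {n m : ℕ} (φ ψ : Fml n m) : Fml n m
  | or {n m : ℕ} (φ ψ : Fml n m) : Fml n m
  | imp {n m : ℕ} (φ ψ : Fml n m) : Fml n m
  | forallNum {n m : ℕ} (φ : Fml (n + 1) m) : Fml n m
  | existsNum {n m : ℕ} (φ : Fml (n + 1) m) : Fml n m
  | forallSet {n m : ℕ} (φ : Fml n (m + 1)) : Fml n m
  | existsSet {n m : ℕ} (φ : Fml n (m + 1)) : Fml n m

/-- Regard a term in `n` variables as a term in `n + 1` variables. -/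
def Term.lift {n : ℕ} : Term n → Term (n + 1)
  | .var i => .var i.castSucc
  | .zero => .zero
  | .one => .one
  | .add s t => .add s.lift t.lift
  | .mul s t => .mul s.lift t.lift

instance {n : ℕ} : Coe (Term n) (Term (n + 1)) := ⟨Term.lift⟩

/-! ### Structures and satisfaction -/

/-- A structure for the language of second-order arithmetic: a first-order part `N` and a
collection `sets` of subsets of `N` over which the set variables range. -/
structure L2Structure : Type (u + 1) where
  N : Type u
  sets : Set (Set N)
  zero : N
  one : N
  add : N → N → N
  mul : N → N → N
  lt : N → N → Prop

/-- The value of a term under an assignment of the number variables. -/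
def Term.eval (M : L2Structure.{u}) {n : ℕ} (v : Fin n → M.N) : Term n → M.N
  | .var i => v i
  | .zero => M.zero
  | .one => M.one
  | .add s t => M.add (s.eval M v) (t.eval M v)
  | .mul s t => M.mul (s.eval M v) (t.eval M v)

/-- Satisfaction of a formula in `M` under assignments `v` of the number variables and `W` of the
set variables. -/
def Fml.Sat (M : L2Structure.{u}) :
    {n m : ℕ} → Fml n m → (Fin n → M.N) → (Fin m → M.sets) → Prop
  | _, _, .eq s t, v, _ => s.eval M v = t.eval M v
  | _, _, .lt s t, v, _ => M.lt (s.eval M v) (t.eval M v)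
  | _, _, .mem t X, v, W => t.eval M v ∈ (W X : Set M.N)
  | _, _, .neg φ, v, W => ¬ φ.Sat M v W
  | _, _, .and φ ψ, v, W => φ.Sat M v W ∧ ψ.Sat M v W
  | _, _, .or φ ψ, v, W => φ.Sat M v W ∨ ψ.Sat M v W
  | _, _, .imp φ ψ, v, W => φ.Sat M v W → ψ.Sat M v W
  | n, _, .forallNum φ, v, W => ∀ a : M.N, φ.Sat M (Fin.snoc (α := fun _ : Fin (n + 1) => M.N) v a) W
  | n, _, .existsNum φ, v, W => ∃ a : M.N, φ.Sat M (Fin.snoc (α := fun _ : Fin (n + 1) => M.N) v a) W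
  | _, m, .forallSet φ, v, W =>
      ∀ A : M.sets, φ.Sat M v (Fin.snoc (α := fun _ : Fin (m + 1) => M.sets) W A)
  | _, m, .existsSet φ, v, W =>
      ∃ A : M.sets, φ.Sat M v (Fin.snoc (α := fun _ : Fin (m + 1) => M.sets) W A)

/-! ### The system of recursive comprehension -/

/-- `Σ⁰₀` formulas: no set quantifiers, and all number quantifiers are bounded, that is of the form
`∀ x < t` or `∃ x < t` where `t` does not contain `x`. Set parameters are allowed. -/
inductive IsSigma0 : {n m : ℕ} → Fml n m → Prop
  | eq {n m : ℕ} (s t : Term n) : IsSigma0 (Fml.eq s t : Fml n m)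
  | lt {n m : ℕ} (s t : Term n) : IsSigma0 (Fml.lt s t : Fml n m)
  | mem {n m : ℕ} (t : Term n) (X : Fin m) : IsSigma0 (Fml.mem t X)
  | neg {n m : ℕ} {φ : Fml n m} : IsSigma0 φ → IsSigma0 φ.neg
  | and {n m : ℕ} {φ ψ : Fml n m} : IsSigma0 φ → IsSigma0 ψ → IsSigma0 (φ.and ψ)
  | or {n m : ℕ} {φ ψ : Fml n m} : IsSigma0 φ → IsSigma0 ψ → IsSigma0 (φ.or ψ)
  | imp {n m : ℕ} {φ ψ : Fml n m} : IsSigma0 φ → IsSigma0 ψ → IsSigma0 (φ.imp ψ)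
  | ballLt {n m : ℕ} (t : Term n) {φ : Fml (n + 1) m} : IsSigma0 φ →
      IsSigma0 (Fml.forallNum ((Fml.lt (Term.var (Fin.last n)) t.lift).imp φ))
  | bexLt {n m : ℕ} (t : Term n) {φ : Fml (n + 1) m} : IsSigma0 φ →
      IsSigma0 (Fml.existsNum ((Fml.lt (Term.var (Fin.last n)) t.lift).and φ))

/-- `Σ⁰₁` formulas: `∃ x θ` with `θ` a `Σ⁰₀` formula. -/
def IsSigma1 {n m : ℕ} (φ : Fml n m) : Prop :=
  ∃ θ : Fml (n + 1) m, IsSigma0 θ ∧ φ = Fml.existsNum θ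

/-- `Π⁰₁` formulas: `∀ x θ` with `θ` a `Σ⁰₀` formula. -/
def IsPi1 {n m : ℕ} (φ : Fml n m) : Prop :=
  ∃ θ : Fml (n + 1) m, IsSigma0 θ ∧ φ = Fml.forallNum θ

/-- `M` is a model of `RCA₀`: it satisfies the basic axioms of arithmetic and the universal closure
of every instance of `Σ⁰₁` induction and of `Δ⁰₁` comprehension (number and set parameters
allowed). -/
structure L2Structure.IsModelRCA0 (M : L2Structure.{u}) : Prop where
  succ_ne_zero : ∀ a : M.N, M.add a M.one ≠ M.zero
  succ_inj : ∀ a b : M.N, M.add a M.one = M.add b M.one → a = b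
  add_zero : ∀ a : M.N, M.add a M.zero = a
  add_succ : ∀ a b : M.N, M.add a (M.add b M.one) = M.add (M.add a b) M.one
  mul_zero : ∀ a : M.N, M.mul a M.zero = M.zero
  mul_succ : ∀ a b : M.N, M.mul a (M.add b M.one) = M.add (M.mul a b) a
  not_lt_zero : ∀ a : M.N, ¬ M.lt a M.zero
  lt_succ : ∀ a b : M.N, M.lt a (M.add b M.one) ↔ M.lt a b ∨ a = b
  sigma1_induction : ∀ {n m : ℕ} (φ : Fml (n + 1) m), IsSigma1 φ →
    ∀ (v : Fin n → M.N) (W : Fin m → M.sets),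
      φ.Sat M (Fin.snoc (α := fun _ : Fin (n + 1) => M.N) v M.zero) W →
      (∀ a : M.N, φ.Sat M (Fin.snoc (α := fun _ : Fin (n + 1) => M.N) v a) W →
        φ.Sat M (Fin.snoc (α := fun _ : Fin (n + 1) => M.N) v (M.add a M.one)) W) →
      ∀ a : M.N, φ.Sat M (Fin.snoc (α := fun _ : Fin (n + 1) => M.N) v a) W
  delta1_comprehension : ∀ {n m : ℕ} (φ ψ : Fml (n + 1) m), IsSigma1 φ → IsPi1 ψ →
    ∀ (v : Fin n → M.N) (W : Fin m → M.sets),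
      (∀ a : M.N, φ.Sat M (Fin.snoc (α := fun _ : Fin (n + 1) => M.N) v a) W ↔
        ψ.Sat M (Fin.snoc (α := fun _ : Fin (n + 1) => M.N) v a) W) →
      ∃ A ∈ M.sets, ∀ a : M.N,
        a ∈ A ↔ φ.Sat M (Fin.snoc (α := fun _ : Fin (n + 1) => M.N) v a) W

/-- The sentence `φ` is a theorem of `RCA₀`, in the form: it holds in every model of `RCA₀`,
`ω`-model or not. -/
def RCA0Proves (φ : Fml 0 0) : Prop :=
  ∀ M : L2Structure.{u}, M.IsModelRCA0 → φ.Sat M Fin.elim0 Fin.elim0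

/-! ### Writing formulas

The quantifiers below hand the bound variable to the body of the formula. -/

section Writing

variable {n m : ℕ}

def all (φ : Term (n + 1) → Fml (n + 1) m) : Fml n m := .forallNum (φ (.var (Fin.last n)))
def ex (φ : Term (n + 1) → Fml (n + 1) m) : Fml n m := .existsNum (φ (.var (Fin.last n)))
def allSet (φ : Fin (m + 1) → Fml n (m + 1)) : Fml n m := .forallSet (φ (Fin.last m))
def exSet (φ : Fin (m + 1) → Fml n (m + 1)) : Fml n m := .existsSet (φ (Fin.last m))

def Fml.iff (φ ψ : Fml n m) : Fml n m := (φ.imp ψ).and (ψ.imp φ)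

infix:50 " ≐ " => Fml.eq
infix:50 " ≺ " => Fml.lt
infix:50 " ∊ " => Fml.mem
infixr:35 " ⋏ " => Fml.and
infixr:30 " ⋎ " => Fml.or
infixr:25 " ⟾ " => Fml.imp
infix:20 " ⟺ " => Fml.iff

/-- The pairing function `(s, t) = (s + t)² + s`. -/
def pair (s t : Term n) : Term n := .add (.mul (.add s t) (.add s t)) s

def triple (r s t : Term n) : Term n := pair r (pair s t)

/-! ### Finite sets and functions -/

/-- `s` divides `t`. -/
def dvd (s t : Term n) : Fml n m := ex fun q => (t : Term (n + 1)) ≐ .mul s q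

/-- `i` is an element of the finite set described by the triple `c = (k, a, b)`, namely
`{i < k : a (i + 1) + 1 divides b}`. -/
def memCode (i c : Term n) : Fml n m :=
  ex fun k => ex fun a => ex fun b =>
    c ≐ triple k a b ⋏ i ≺ k ⋏ dvd (.add (.mul a (.add i .one)) .one) b

/-- `c` and `d` describe the same finite set. -/
def sameCode (c d : Term n) : Fml n m := all fun i => memCode i c ⟺ memCode i d

/-- `c` is the code of a finite set: the least triple describing that set. -/
def isCode (c : Term n) : Fml n m :=
  (ex fun k => ex fun a => ex fun b => c ≐ triple k a b) ⋏
  (all fun d => (ex fun k => ex fun a => ex fun b => d ≐ triple k a b) ⋏ sameCode c d ⟾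
    .neg (d ≺ c))

/-- The set `F` is (the graph of) a function from numbers to numbers. -/
def isFun (F : Fin m) : Fml n m :=
  (all fun p => p ∊ F ⟾ ex fun i => ex fun y => p ≐ pair i y) ⋏
  (all fun i => ex fun y => pair i y ∊ F) ⋏
  (all fun i => all fun y => all fun z => pair i y ∊ F ⋏ pair i z ∊ F ⟾ y ≐ z)

/-- `F(i) = y`. -/
def app (F : Fin m) (i y : Term n) : Fml n m := pair i y ∊ F

/-! ### Size-change graphs

Function identifiers are numbers. The set variable `V` stands for a function assigning to every
function identifier `f` the code of its finite set `Var(f)` of parameters. The size-change graph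
`G : f → g` with set of edges `E` is the number `(f, g, e)`, where `e` is the code of `E`; the edge
from `x` to `y` with label `r` is the number `(x, r, y)`. -/

/-- The label `↓` of strict arcs. -/
def down : Term n := .zero

/-- The label `⇓` of non-strict arcs. -/
def Down : Term n := .one

/-- `r ∈ {↓, ⇓}`. -/
def isLabel (r : Term n) : Fml n m := r ≐ down ⋎ r ≐ Down

/-- `V` assigns to every function identifier a finite set of parameters. -/
def isVar (V : Fin m) : Fml n m :=
  isFun V ⋏ all fun f => all fun c => app V f c ⟾ isCode c

/-- `x ∈ Var(f)`. -/
def inVar (V : Fin m) (f x : Term n) : Fml n m := ex fun c => app V f c ⋏ memCode x c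

/-- `f` is the source function of `G`. -/
def source (G f : Term n) : Fml n m := ex fun g => ex fun e => G ≐ triple f g e

/-- `g` is the target function of `G`. -/
def target (G g : Term n) : Fml n m := ex fun f => ex fun e => G ≐ triple f g e

/-- `(x, r, y)` is an edge of `G`. -/
def arc (G x r y : Term n) : Fml n m :=
  ex fun f => ex fun g => ex fun e => G ≐ triple f g e ⋏ memCode (triple x r y) e

/-- `G` has an edge from `x` to `y`, strict or not. -/
def anyArc (G x y : Term n) : Fml n m := arc G x down y ⋎ arc G x Down y

/-- `G` is a size-change graph: its edges form a finite subset of `Var(f) × {↓, ⇓} × Var(g)`, where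
`f` and `g` are its source and target, with at most one edge between any two parameters. -/
def isGraph (V : Fin m) (G : Term n) : Fml n m :=
  (ex fun f => ex fun g => ex fun e => G ≐ triple f g e ⋏ isCode e ⋏
    all fun p => memCode p e ⟾
      ex fun x => ex fun r => ex fun y =>
        p ≐ triple x r y ⋏ inVar V f x ⋏ isLabel r ⋏ inVar V g y) ⋏
  (all fun x => all fun y => .neg (arc G x down y ⋏ arc G x Down y))

/-- `H` is the composition `G₀; G₁` of the size-change graphs `G₀ : f → g` and `G₁ : g → h`. -/
def isComp (V : Fin m) (G₀ G₁ H : Term n) : Fml n m :=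
  isGraph V G₀ ⋏ isGraph V G₁ ⋏ isGraph V H ⋏
  ex fun f => ex fun g => ex fun h =>
    source G₀ f ⋏ target G₀ g ⋏ source G₁ g ⋏ target G₁ h ⋏ source H f ⋏ target H h ⋏
    (all fun x => all fun z =>
      (arc H x down z ⟺
        ex fun y => inVar V g y ⋏ ex fun r => isLabel r ⋏
          ((arc G₀ x down y ⋏ arc G₁ y r z) ⋎ (arc G₀ x r y ⋏ arc G₁ y down z))) ⋏
      (arc H x Down z ⟺
        (ex fun y => inVar V g y ⋏ arc G₀ x Down y ⋏ arc G₁ y Down z) ⋏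
        (all fun y => inVar V g y ⟾ all fun r => all fun s => isLabel r ⟾ isLabel s ⟾
          (arc G₀ x r y ⋏ arc G₁ y s z ⟾ r ≐ Down ⋏ s ≐ Down))))

/-- `G; G = G`. -/
def isIdempotent (V : Fin m) (G : Term n) : Fml n m := isComp V G G G

/-- `𝒢` is a finite set of size-change graphs. -/
def isFiniteGraphSet (V 𝒢 : Fin m) : Fml n m :=
  (ex fun b => all fun G => G ∊ 𝒢 ⟾ G ≺ b) ⋏ (all fun G => G ∊ 𝒢 ⟾ isGraph V G)

/-- `G ∈ cl(𝒢)`: `G` belongs to every set that contains `𝒢` and is closed under composition. -/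
def inCl (V 𝒢 : Fin m) (G : Term n) : Fml n m :=
  allSet fun X =>
    (all fun H => H ∊ 𝒢.castSucc ⟾ H ∊ X) ⋏
    (all fun G₀ => all fun G₁ => all fun H =>
      G₀ ∊ X ⋏ G₁ ∊ X ⋏ isComp V.castSucc G₀ G₁ H ⟾ H ∊ X) ⟾
    G ∊ X

/-- `P` is a multipath `G₀, G₁, G₂, …` all of whose graphs belong to `𝒢`. -/
def isMultipath (𝒢 P : Fin m) : Fml n m :=
  isFun P ⋏
  (all fun i => all fun G => app P i G ⟾ G ∊ 𝒢) ⋏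
  (all fun i => all fun G => all fun H => app P i G ⋏ app P (.add i .one) H ⟾
    ex fun g => target G g ⋏ source H g)

/-- The multipath `P` has infinite descent: for some `t` there are parameters `x₀, x₁, x₂, …` with
an edge from `xᵢ` to `xᵢ₊₁` in `G_{t+i}` for every `i`, and infinitely many of these edges are
decreasing. -/
def infiniteDescent (P : Fin m) : Fml n m :=
  ex fun t => exSet fun T => isFun T ⋏
    (all fun i => all fun G => all fun x => all fun y =>
      app P.castSucc (.add t i) G ⋏ app T i x ⋏ app T (.add i .one) y ⟾ anyArc G x y) ⋏
    (all fun k => ex fun i => ex fun G => ex fun x => ex fun y =>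
      .neg (i ≺ k) ⋏
      app P.castSucc (.add t i) G ⋏ app T i x ⋏ app T (.add i .one) y ⋏ arc G x down y)

end Writing

/-- For every assignment of parameters to functions and every finite set `𝒢` of size-change graphs:
if every multipath over `𝒢` has infinite descent, then every idempotent `G ∈ cl(𝒢)` has a strict
arc from some `x` to itself. -/
def sctCriterionForward : Fml 0 0 :=
  allSet fun V => allSet fun 𝒢 =>
    isVar V.castSucc ⋏ isFiniteGraphSet V.castSucc 𝒢 ⟾
    (allSet fun P => isMultipath 𝒢.castSucc P ⟾ infiniteDescent P) ⟾
    all fun G => inCl V.castSucc 𝒢 G ⋏ isIdempotent V.castSucc G ⟾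
      ex fun x => arc G x down x

end SOA

namespace SOA

set_option linter.unusedSectionVars false

variable {M : L2Structure.{u}}

/-! Write the idempotent `G` as a left-bracketed composition `g₀; …; g_l` of members of `𝒢` and
repeat `g₀, …, g_l` forever. This is a multipath, since the idempotent `G` has equal source and
target. Cut a thread of infinite descent at the multiples of the period `l + 1`: between consecutive
cuts there is an arc of `G`, infinitely often strict, and by idempotence every cut value has a
strict `G`-arc to some later cut value (`IsDerivation.exists_strict_arc`). Strict `G`-arcs form a
transitive relation on a bounded set of parameters. Without a strict loop the relation would be
irreflexive, so some cut value would be maximal, a contradiction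
(`IsDerivation.exists_strict_loop`).

Two points need care in a possibly nonstandard model with only `Σ⁰₁` induction. First, membership in
`cl(𝒢)` means membership in every closed set of the model, so a derivation of `G` is found by
exhibiting a suitable closed set (`exists_isDerivation`). Derivability is `Σ⁰₁`, and it defines a
set because graphs over bounded data have bounded codes (`exists_graph_bound`) and bounded `Σ⁰₁`
comprehension is available. Associativity of composition turns arbitrary bracketings into
left-bracketed ones.

Second, the pigeonhole argument is replaced by `exists_maximal_of_bounded`. It and bounded
comprehension code a subset of `[0, k)` by the independent moduli `a (i + 1) + 1` dividing a number;
removing an element means dividing by its modulus, so the `Σ⁰₁` least number principle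
(`sigma1_least`) selects extremal sets.

Definability is handled semantically: `Sigma0Pred` describes `Σ⁰₀` predicates with parameters
without syntax, and `Sigma0Pred.exists_fml` returns to formulas when an axiom is applied. -/

instance (M : L2Structure.{u}) : Zero M.N := ⟨M.zero⟩
instance (M : L2Structure.{u}) : One M.N := ⟨M.one⟩
instance (M : L2Structure.{u}) : Add M.N := ⟨M.add⟩
instance (M : L2Structure.{u}) : Mul M.N := ⟨M.mul⟩
instance (M : L2Structure.{u}) : LT M.N := ⟨M.lt⟩

/-! ### Predicates definable by `Σ⁰₀` formulas with parameters -/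

/-- Functions given by number terms with parameters from the structure. -/
inductive PolyFun (M : L2Structure.{u}) : {n : ℕ} → ((Fin n → M.N) → M.N) → Prop
  | var {n : ℕ} (i : Fin n) : PolyFun M fun x => x i
  | const {n : ℕ} (a : M.N) : PolyFun M fun _ : Fin n → M.N => a
  | add {n : ℕ} {s t : (Fin n → M.N) → M.N} :
      PolyFun M s → PolyFun M t → PolyFun M fun x => s x + t x
  | mul {n : ℕ} {s t : (Fin n → M.N) → M.N} :
      PolyFun M s → PolyFun M t → PolyFun M fun x => s x * t x

/-- Predicates given by `Σ⁰₀` formulas with number and set parameters from the structure. -/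
inductive Sigma0Pred (M : L2Structure.{u}) : {n : ℕ} → ((Fin n → M.N) → Prop) → Prop
  | eq {n : ℕ} {s t : (Fin n → M.N) → M.N} :
      PolyFun M s → PolyFun M t → Sigma0Pred M fun x => s x = t x
  | lt {n : ℕ} {s t : (Fin n → M.N) → M.N} :
      PolyFun M s → PolyFun M t → Sigma0Pred M fun x => s x < t x
  | mem {n : ℕ} {t : (Fin n → M.N) → M.N} {A : Set M.N} :
      PolyFun M t → A ∈ M.sets → Sigma0Pred M fun x => t x ∈ A
  | neg {n : ℕ} {P : (Fin n → M.N) → Prop} : Sigma0Pred M P → Sigma0Pred M fun x => ¬ P x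
  | and {n : ℕ} {P Q : (Fin n → M.N) → Prop} :
      Sigma0Pred M P → Sigma0Pred M Q → Sigma0Pred M fun x => P x ∧ Q x
  | ball {n : ℕ} {t : (Fin n → M.N) → M.N} {Q : (Fin n → M.N) → M.N → Prop} :
      PolyFun M t → (Sigma0Pred M fun y : Fin (n + 1) → M.N => Q (Fin.init y) (y (Fin.last n))) →
      Sigma0Pred M fun x => ∀ a, a < t x → Q x a

theorem Term.eval_lift {n : ℕ} (t : Term n) (v : Fin n → M.N) (a : M.N) :
    t.lift.eval M (Fin.snoc (α := fun _ : Fin (n + 1) => M.N) v a) = t.eval M v := by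
  induction t with
  | var i => simp [Term.lift, Term.eval]
  | zero => rfl
  | one => rfl
  | add s t hs ht => simp [Term.lift, Term.eval, hs, ht]
  | mul s t hs ht => simp [Term.lift, Term.eval, hs, ht]

theorem PolyFun.lift {n : ℕ} {t : (Fin n → M.N) → M.N} (ht : PolyFun M t) :
    PolyFun M fun x : Fin (n + 1) → M.N => t (Fin.init x) := by
  induction ht with
  | var i => exact .var i.castSucc
  | const a => exact .const a
  | add _ _ hs ht => exact .add hs ht
  | mul _ _ hs ht => exact .mul hs ht

theorem append_comp_left {α : Type*} {p q k : ℕ} {v : Fin k → α} {f : Fin (p + q) → Fin k}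
    {a : Fin p → α} {b : Fin q → α} (h : v ∘ f = Fin.append a b) :
    v ∘ (f ∘ Fin.castAdd q) = a := by
  funext i
  simpa using congrFun h (Fin.castAdd q i)

theorem append_comp_right {α : Type*} {p q k : ℕ} {v : Fin k → α} {f : Fin (p + q) → Fin k}
    {a : Fin p → α} {b : Fin q → α} (h : v ∘ f = Fin.append a b) :
    v ∘ (f ∘ Fin.natAdd p) = b := by
  funext i
  simpa using congrFun h (Fin.natAdd p i)

/-- The parameters `v₀` are fixed before the context `k` and the placements `f`, `x` are chosen. Two
subterms can then share one context holding both parameter lists, and the context may grow under a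
binder. -/
theorem PolyFun.exists_term {n : ℕ} {t : (Fin n → M.N) → M.N} (h : PolyFun M t) :
    ∃ (p : ℕ) (v₀ : Fin p → M.N), ∀ (k : ℕ) (f : Fin p → Fin k) (x : Fin n → Fin k),
      ∃ τ : Term k, ∀ v : Fin k → M.N, v ∘ f = v₀ → τ.eval M v = t (v ∘ x) := by
  induction h with
  | var i => exact ⟨0, Fin.elim0, fun k f x => ⟨.var (x i), fun v _ => rfl⟩⟩
  | const a =>
    exact ⟨1, fun _ => a, fun k f x => ⟨.var (f 0), fun v hv => congrFun hv 0⟩⟩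
  | add _ _ hs ht =>
    obtain ⟨p, a, hs⟩ := hs
    obtain ⟨q, b, ht⟩ := ht
    refine ⟨p + q, Fin.append a b, fun k f x => ?_⟩
    obtain ⟨σ, hσ⟩ := hs k (f ∘ Fin.castAdd q) x
    obtain ⟨τ, hτ⟩ := ht k (f ∘ Fin.natAdd p) x
    refine ⟨.add σ τ, fun v hv => ?_⟩
    simp only [Term.eval, hσ v (append_comp_left hv), hτ v (append_comp_right hv)]
    rfl
  | mul _ _ hs ht =>
    obtain ⟨p, a, hs⟩ := hs
    obtain ⟨q, b, ht⟩ := ht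
    refine ⟨p + q, Fin.append a b, fun k f x => ?_⟩
    obtain ⟨σ, hσ⟩ := hs k (f ∘ Fin.castAdd q) x
    obtain ⟨τ, hτ⟩ := ht k (f ∘ Fin.natAdd p) x
    refine ⟨.mul σ τ, fun v hv => ?_⟩
    simp only [Term.eval, hσ v (append_comp_left hv), hτ v (append_comp_right hv)]
    rfl

/-- This is the bridge from semantic definability to the axiom schemes. As for terms, the statement
is uniform in the context; a bounded quantifier uses it at `k + 1`, with the bound variable placed
last. -/
theorem Sigma0Pred.exists_fml {n : ℕ} {P : (Fin n → M.N) → Prop} (h : Sigma0Pred M P) :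
    ∃ (p : ℕ) (v₀ : Fin p → M.N) (q : ℕ) (W₀ : Fin q → M.sets),
      ∀ (k l : ℕ) (f : Fin p → Fin k) (g : Fin q → Fin l) (x : Fin n → Fin k),
      ∃ φ : Fml k l, IsSigma0 φ ∧ ∀ (v : Fin k → M.N) (W : Fin l → M.sets),
        v ∘ f = v₀ → W ∘ g = W₀ → (φ.Sat M v W ↔ P (v ∘ x)) := by
  induction h with
  | eq hs ht =>
    obtain ⟨p, a, hs⟩ := hs.exists_term
    obtain ⟨p', b, ht⟩ := ht.exists_term
    refine ⟨p + p', Fin.append a b, 0, Fin.elim0, fun k l f g x => ?_⟩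
    obtain ⟨σ, hσ⟩ := hs k (f ∘ Fin.castAdd p') x
    obtain ⟨τ, hτ⟩ := ht k (f ∘ Fin.natAdd p) x
    refine ⟨.eq σ τ, .eq σ τ, fun v W hv _ => ?_⟩
    simp only [Fml.Sat, hσ v (append_comp_left hv), hτ v (append_comp_right hv)]
  | lt hs ht =>
    obtain ⟨p, a, hs⟩ := hs.exists_term
    obtain ⟨p', b, ht⟩ := ht.exists_term
    refine ⟨p + p', Fin.append a b, 0, Fin.elim0, fun k l f g x => ?_⟩
    obtain ⟨σ, hσ⟩ := hs k (f ∘ Fin.castAdd p') x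
    obtain ⟨τ, hτ⟩ := ht k (f ∘ Fin.natAdd p) x
    refine ⟨.lt σ τ, .lt σ τ, fun v W hv _ => ?_⟩
    simp only [Fml.Sat, hσ v (append_comp_left hv), hτ v (append_comp_right hv)]
    rfl
  | @mem n t A ht hA =>
    obtain ⟨p, a, ht⟩ := ht.exists_term
    refine ⟨p, a, 1, fun _ => ⟨A, hA⟩, fun k l f g x => ?_⟩
    obtain ⟨τ, hτ⟩ := ht k f x
    refine ⟨.mem τ (g 0), .mem τ (g 0), fun v W hv hW => ?_⟩
    have h0 : W (g 0) = ⟨A, hA⟩ := congrFun hW 0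
    simp only [Fml.Sat, hτ v hv, h0]
  | neg _ hP =>
    obtain ⟨p, a, q, A, hP⟩ := hP
    refine ⟨p, a, q, A, fun k l f g x => ?_⟩
    obtain ⟨φ, hφ, hφP⟩ := hP k l f g x
    exact ⟨φ.neg, hφ.neg, fun v W hv hW => not_congr (hφP v W hv hW)⟩
  | and _ _ hP hQ =>
    obtain ⟨p, a, q, A, hP⟩ := hP
    obtain ⟨p', b, q', B, hQ⟩ := hQ
    refine ⟨p + p', Fin.append a b, q + q', Fin.append A B, fun k l f g x => ?_⟩
    obtain ⟨φ, hφ, hφP⟩ := hP k l (f ∘ Fin.castAdd p') (g ∘ Fin.castAdd q') x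
    obtain ⟨ψ, hψ, hψQ⟩ := hQ k l (f ∘ Fin.natAdd p) (g ∘ Fin.natAdd q) x
    exact ⟨φ.and ψ, hφ.and hψ, fun v W hv hW => and_congr
      (hφP v W (append_comp_left hv) (append_comp_left hW))
      (hψQ v W (append_comp_right hv) (append_comp_right hW))⟩
  | @ball n t Q ht _ hQ =>
    obtain ⟨p, a, ht⟩ := ht.exists_term
    obtain ⟨p', b, q, B, hQ⟩ := hQ
    refine ⟨p + p', Fin.append a b, q, B, fun k l f g x => ?_⟩
    obtain ⟨τ, hτ⟩ := ht k (f ∘ Fin.castAdd p') x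
    obtain ⟨φ, hφ, hφQ⟩ := hQ (k + 1) l (Fin.castSucc ∘ f ∘ Fin.natAdd p) g
      (Fin.snoc (α := fun _ => Fin (k + 1)) (Fin.castSucc ∘ x) (Fin.last k))
    refine ⟨_, .ballLt τ hφ, fun v W hv hW => forall_congr' fun c => imp_congr ?_ ?_⟩
    · simp only [Fml.Sat, Term.eval_lift, hτ v (append_comp_left hv), Term.eval, Fin.snoc_last]
      rfl
    · rw [hφQ _ _ _ hW]
      · have h1 : Fin.init ((Fin.snoc v c : Fin (k + 1) → M.N) ∘
            (Fin.snoc (Fin.castSucc ∘ x) (Fin.last k) : Fin (n + 1) → Fin (k + 1))) = v ∘ x := by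
          funext i
          simp [Fin.init]
        beta_reduce
        rw [h1]
        simp
      · rw [← append_comp_right hv]
        funext i
        simp

theorem Sigma0Pred.congr {n : ℕ} {P Q : (Fin n → M.N) → Prop} (h : Sigma0Pred M P)
    (hPQ : ∀ x, Q x ↔ P x) : Sigma0Pred M Q := by
  rwa [show Q = P from funext fun x => propext (hPQ x)]

theorem Sigma0Pred.imp {n : ℕ} {P Q : (Fin n → M.N) → Prop} (hP : Sigma0Pred M P)
    (hQ : Sigma0Pred M Q) : Sigma0Pred M fun x => P x → Q x :=
  (hP.and hQ.neg).neg.congr fun x => by tauto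

theorem Sigma0Pred.or {n : ℕ} {P Q : (Fin n → M.N) → Prop} (hP : Sigma0Pred M P)
    (hQ : Sigma0Pred M Q) : Sigma0Pred M fun x => P x ∨ Q x :=
  (hP.neg.and hQ.neg).neg.congr fun x => by tauto

theorem Sigma0Pred.iff {n : ℕ} {P Q : (Fin n → M.N) → Prop} (hP : Sigma0Pred M P)
    (hQ : Sigma0Pred M Q) : Sigma0Pred M fun x => (P x ↔ Q x) :=
  ((hP.imp hQ).and (hQ.imp hP)).congr fun x => by tauto

theorem Sigma0Pred.bex {n : ℕ} {t : (Fin n → M.N) → M.N} {Q : (Fin n → M.N) → M.N → Prop}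
    (ht : PolyFun M t)
    (hQ : Sigma0Pred M fun y : Fin (n + 1) → M.N => Q (Fin.init y) (y (Fin.last n))) :
    Sigma0Pred M fun x => ∃ a, a < t x ∧ Q x a :=
  (Sigma0Pred.ball (Q := fun x a => ¬ Q x a) ht hQ.neg).neg.congr fun x => by
    push Not; rfl

/-! ### Induction and comprehension -/

variable [hM : Fact M.IsModelRCA0]

theorem sigma1_induction {P : M.N → M.N → Prop}
    (hP : Sigma0Pred M fun x : Fin 2 → M.N => P (x 0) (x 1)) (h0 : ∃ w, P 0 w)
    (hs : ∀ a, (∃ w, P a w) → ∃ w, P (a + 1) w) (a : M.N) : ∃ w, P a w := by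
  obtain ⟨p, v, q, W, h⟩ := hP.exists_fml
  obtain ⟨φ, hφ, hφP⟩ := h (p + 1 + 1) q (Fin.castSucc ∘ Fin.castSucc) id
    ![(Fin.last p).castSucc, Fin.last (p + 1)]
  have key : ∀ b, (Fml.existsNum φ).Sat M
      (Fin.snoc (α := fun _ : Fin (p + 1) => M.N) v b) W ↔ ∃ w, P b w := fun b =>
    exists_congr fun w => by
      rw [hφP _ _ _ rfl]
      · simp
      · funext i; simp
  rw [← key]
  refine hM.out.sigma1_induction φ.existsNum ⟨φ, hφ, rfl⟩ v W ((key _).2 h0) ?_ a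
  intro b hb
  exact (key _).2 (hs b ((key b).1 hb))

/-- The idle second variable lets `P` serve as the matrix of a `Σ⁰₁` formula with a vacuous
quantifier. -/
theorem sigma0_induction {P : M.N → Prop} (hP : Sigma0Pred M fun x : Fin 2 → M.N => P (x 0))
    (h0 : P 0) (hs : ∀ a, P a → P (a + 1)) (a : M.N) : P a :=
  (sigma1_induction (P := fun a _ => P a) hP ⟨0, h0⟩ (fun a ⟨_, h⟩ => ⟨0, hs a h⟩) a).elim
    fun _ h => h

theorem sigma0_comprehension {P : M.N → Prop}
    (hP : Sigma0Pred M fun x : Fin 2 → M.N => P (x 0)) : {a | P a} ∈ M.sets := by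
  obtain ⟨p, v, q, W, h⟩ := hP.exists_fml
  obtain ⟨φ, hφ, hφP⟩ := h (p + 1 + 1) q (Fin.castSucc ∘ Fin.castSucc) id
    ![(Fin.last p).castSucc, Fin.last (p + 1)]
  have key : ∀ b c, φ.Sat M (Fin.snoc (α := fun _ : Fin (p + 1 + 1) => M.N)
      (Fin.snoc (α := fun _ : Fin (p + 1) => M.N) v b) c) W ↔ P b := fun b c => by
    rw [hφP _ _ _ rfl]
    · simp
    · funext i; simp
  obtain ⟨A, hA, hAP⟩ := hM.out.delta1_comprehension φ.existsNum φ.forallNum ⟨φ, hφ, rfl⟩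
    ⟨φ, hφ, rfl⟩ v W fun b => ⟨fun ⟨c, hc⟩ d => (key b d).2 ((key b c).1 hc),
      fun h => ⟨0, h 0⟩⟩
  convert hA
  ext b
  rw [hAP]
  exact ⟨fun h => ⟨0, (key b 0).2 h⟩, fun ⟨c, hc⟩ => (key b c).1 hc⟩

/-! ### Arithmetic in a model -/

namespace Model

theorem add_zero (a : M.N) : a + 0 = a := hM.out.add_zero a
theorem add_succ (a b : M.N) : a + (b + 1) = a + b + 1 := hM.out.add_succ a b
theorem mul_zero (a : M.N) : a * 0 = 0 := hM.out.mul_zero a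
theorem mul_succ (a b : M.N) : a * (b + 1) = a * b + a := hM.out.mul_succ a b
theorem succ_ne_zero (a : M.N) : a + 1 ≠ 0 := hM.out.succ_ne_zero a
theorem succ_inj {a b : M.N} (h : a + 1 = b + 1) : a = b := hM.out.succ_inj a b h
theorem not_lt_zero (a : M.N) : ¬ a < 0 := hM.out.not_lt_zero a
theorem lt_succ {a b : M.N} : a < b + 1 ↔ a < b ∨ a = b := hM.out.lt_succ a b

theorem zero_add (a : M.N) : 0 + a = a :=
  sigma0_induction (P := fun a => 0 + a = a) (.eq (.add (.const _) (.var _)) (.var _))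
    (add_zero 0) (fun a h => by rw [add_succ, h]) a

theorem succ_add (a b : M.N) : a + 1 + b = a + b + 1 :=
  sigma0_induction (P := fun b => a + 1 + b = a + b + 1)
    (.eq (.add (.const _) (.var _)) (.add (.add (.const _) (.var _)) (.const _)))
    (by rw [add_zero, add_zero]) (fun b h => by rw [add_succ, h, add_succ]) b

theorem add_comm (a b : M.N) : a + b = b + a :=
  sigma0_induction (P := fun b => a + b = b + a)
    (.eq (.add (.const _) (.var _)) (.add (.var _) (.const _)))
    (by rw [add_zero, zero_add]) (fun b h => by rw [add_succ, h, succ_add]) b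

theorem add_assoc (a b c : M.N) : a + b + c = a + (b + c) :=
  sigma0_induction (P := fun c => a + b + c = a + (b + c))
    (.eq (.add (.const _) (.var _)) (.add (.const _) (.add (.const _) (.var _))))
    (by rw [add_zero, add_zero]) (fun c h => by rw [add_succ, h, add_succ, add_succ]) c

theorem mul_add (a b c : M.N) : a * (b + c) = a * b + a * c :=
  sigma0_induction (P := fun c => a * (b + c) = a * b + a * c)
    (.eq (.mul (.const _) (.add (.const _) (.var _)))
      (.add (.const _) (.mul (.const _) (.var _))))
    (by rw [add_zero, mul_zero, add_zero])
    (fun c h => by rw [add_succ, mul_succ, mul_succ, h, add_assoc]) c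

theorem zero_mul (a : M.N) : 0 * a = 0 :=
  sigma0_induction (P := fun a => 0 * a = 0) (.eq (.mul (.const _) (.var _)) (.const _))
    (mul_zero 0) (fun a h => by rw [mul_succ, h, add_zero]) a

theorem succ_mul (a b : M.N) : (a + 1) * b = a * b + b :=
  sigma0_induction (P := fun b => (a + 1) * b = a * b + b)
    (.eq (.mul (.const _) (.var _)) (.add (.mul (.const _) (.var _)) (.var _)))
    (by rw [mul_zero, mul_zero, add_zero])
    (fun b h => by
      rw [mul_succ, h, mul_succ, add_assoc, add_assoc, add_succ b a, add_succ a b,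
        add_comm a b]) b

theorem mul_comm (a b : M.N) : a * b = b * a :=
  sigma0_induction (P := fun b => a * b = b * a)
    (.eq (.mul (.const _) (.var _)) (.mul (.var _) (.const _)))
    (by rw [mul_zero, zero_mul]) (fun b h => by rw [mul_succ, h, succ_mul]) b

theorem mul_assoc (a b c : M.N) : a * b * c = a * (b * c) :=
  sigma0_induction (P := fun c => a * b * c = a * (b * c))
    (.eq (.mul (.const _) (.var _)) (.mul (.const _) (.mul (.const _) (.var _))))
    (by rw [mul_zero, mul_zero, mul_zero])
    (fun c h => by rw [mul_succ, h, mul_succ, mul_add]) c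

theorem mul_one (a : M.N) : a * 1 = a := by
  rw [← zero_add (1 : M.N), mul_succ, mul_zero, zero_add]

theorem add_right_cancel {a b : M.N} (c : M.N) : a + c = b + c → a = b :=
  sigma0_induction (P := fun c => a + c = b + c → a = b)
    (.imp (.eq (.add (.const _) (.var _)) (.add (.const _) (.var _)))
      (.eq (.const _) (.const _)))
    (by rw [add_zero, add_zero]; exact id)
    (fun c h e => h (succ_inj (by rw [← add_succ, ← add_succ, e]))) c

end Model

/-! ### The ordered semiring of numbers -/

instance : CommSemiring M.N where
  add_assoc := Model.add_assoc
  zero_add := Model.zero_add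
  add_zero := Model.add_zero
  add_comm := Model.add_comm
  left_distrib := Model.mul_add
  right_distrib a b c := by
    rw [Model.mul_comm, Model.mul_add, Model.mul_comm c, Model.mul_comm c]
  zero_mul := Model.zero_mul
  mul_zero := Model.mul_zero
  mul_assoc := Model.mul_assoc
  one_mul a := by rw [Model.mul_comm, Model.mul_one]
  mul_one := Model.mul_one
  mul_comm := Model.mul_comm
  nsmul := nsmulRec

namespace Model

theorem eq_zero_or_succ (a : M.N) : a = 0 ∨ ∃ b, a = b + 1 := by
  by_contra! h
  obtain ⟨b, hb⟩ := sigma1_induction (P := fun a b => a = 0 ∨ a = b + 1)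
    (.or (.eq (.var _) (.const _)) (.eq (.var _) (.add (.var _) (.const _))))
    ⟨0, .inl rfl⟩ (fun a _ => ⟨a, .inr rfl⟩) a
  exact hb.elim h.1 (h.2 b)

/-- The axioms determine `<` only through `lt_succ`. Pulling the witness in front of the implication
makes the forward direction a `Σ⁰₁` induction on `b`. -/
theorem lt_iff_exists {a b : M.N} : a < b ↔ ∃ c, a + (c + 1) = b := by
  constructor
  · intro hab
    obtain ⟨c, hc⟩ := sigma1_induction (P := fun b c => a < b → a + (c + 1) = b)
      (.imp (.lt (.const _) (.var _))
        (.eq (.add (.const _) (.add (.var _) (.const _))) (.var _)))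
      ⟨0, fun h => (not_lt_zero _ h).elim⟩
      (fun b ⟨c, hc⟩ => by
        by_cases h : a < b
        · exact ⟨c + 1, fun _ => by rw [← hc h, ← _root_.add_assoc a]⟩
        · exact ⟨0, fun h' => by
            rw [(lt_succ.1 h').resolve_left h, _root_.zero_add]⟩) b
    exact ⟨c, hc hab⟩
  · rintro ⟨c, rfl⟩
    refine sigma0_induction (P := fun c => a < a + (c + 1))
      (.lt (.const _) (.add (.const _) (.add (.var _) (.const _)))) ?_ ?_ c
    · rw [_root_.zero_add]; exact lt_succ.2 (.inr rfl)
    · intro c hc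
      rw [← _root_.add_assoc]; exact lt_succ.2 (.inl hc)

theorem add_eq_self {a c : M.N} (h : a + c = a) : c = 0 :=
  add_right_cancel a (by rw [_root_.zero_add, _root_.add_comm, h])

theorem eq_zero_of_add_eq_zero {a b : M.N} (h : a + b = 0) : b = 0 := by
  rcases eq_zero_or_succ b with hb | ⟨c, rfl⟩
  · exact hb
  · exact (succ_ne_zero (a + c) (by rw [← h, _root_.add_assoc])).elim

instance : LE M.N := ⟨fun a b => ∃ c, a + c = b⟩

theorem le_total (a b : M.N) : a ≤ b ∨ b ≤ a := by
  obtain ⟨c, hc⟩ := sigma1_induction (P := fun a c => a + c = b ∨ b + c = a)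
    (.or (.eq (.add (.var _) (.var _)) (.const _)) (.eq (.add (.const _) (.var _)) (.var _)))
    ⟨b, .inl (_root_.zero_add b)⟩
    (fun a ⟨c, hc⟩ => by
      rcases hc with hc | hc
      · rcases eq_zero_or_succ c with rfl | ⟨d, rfl⟩
        · exact ⟨1, .inr (by rw [← hc, _root_.add_zero])⟩
        · exact ⟨d, .inl (by rw [← hc]; ring)⟩
      · exact ⟨c + 1, .inr (by rw [← hc]; ring)⟩) a
  exact hc.imp (fun h => ⟨c, h⟩) fun h => ⟨c, h⟩

end Model

noncomputable instance : LinearOrder M.N where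
  le_refl a := ⟨0, add_zero a⟩
  le_trans := by
    rintro a _ _ ⟨c, rfl⟩ ⟨d, rfl⟩
    exact ⟨c + d, (add_assoc _ _ _).symm⟩
  le_antisymm := by
    rintro a _ ⟨c, rfl⟩ ⟨d, h⟩
    have h0 : d + c = 0 := Model.add_eq_self (a := a) (by
      rw [add_comm d, ← add_assoc, h])
    rw [Model.eq_zero_of_add_eq_zero h0, add_zero]
  lt_iff_le_not_ge a b := by
    rw [Model.lt_iff_exists]
    constructor
    · rintro ⟨c, rfl⟩
      refine ⟨⟨c + 1, rfl⟩, fun ⟨d, h⟩ => ?_⟩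
      exact Model.succ_ne_zero (d + c) (Model.add_eq_self (a := a) (by
        rw [← add_assoc] at h
        calc a + (d + c + 1) = a + c + 1 + d := by ring
          _ = a := h))
    · rintro ⟨⟨c, rfl⟩, h⟩
      rcases Model.eq_zero_or_succ c with rfl | ⟨d, rfl⟩
      · exact (h ⟨0, by ring⟩).elim
      · exact ⟨d, rfl⟩
  le_total := Model.le_total
  toDecidableLE := Classical.decRel _

instance : CanonicallyOrderedAdd M.N where
  exists_add_of_le := fun ⟨c, h⟩ => ⟨c, h.symm⟩
  le_add_self a b := ⟨b, add_comm a b⟩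
  le_self_add _ b := ⟨b, rfl⟩

instance : IsOrderedCancelAddMonoid M.N where
  add_le_add_left := by
    rintro a _ ⟨c, rfl⟩ d
    exact ⟨c, by ring⟩
  le_of_add_le_add_left := by
    rintro a b c ⟨d, h⟩
    exact ⟨d, Model.add_right_cancel a (by rw [← add_comm a c, ← h]; ring)⟩

theorem Model.lt_add_one_iff {a b : M.N} : a < b + 1 ↔ a ≤ b :=
  Model.lt_succ.trans le_iff_lt_or_eq.symm

theorem Model.add_one_le_iff {a b : M.N} : a + 1 ≤ b ↔ a < b := by
  rw [Model.lt_iff_exists]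
  exact ⟨fun ⟨c, h⟩ => ⟨c, by rw [← h]; ring⟩, fun ⟨c, h⟩ => ⟨c, by rw [← h]; ring⟩⟩

theorem Model.lt_succ_self (a : M.N) : a < a + 1 := Model.lt_add_one_iff.2 le_rfl

instance : Nontrivial M.N := ⟨0, 1, fun h => Model.succ_ne_zero (0 : M.N) (by rw [zero_add, h])⟩

theorem Model.mul_lt_mul_left {a b c : M.N} (hc : 0 < c) (h : a < b) : c * a < c * b := by
  obtain ⟨d, rfl⟩ := Model.lt_iff_exists.1 h
  obtain ⟨e, rfl⟩ := Model.lt_iff_exists.1 hc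
  exact Model.lt_iff_exists.2 ⟨e * d + d + e, by ring⟩

instance : IsStrictOrderedRing M.N where
  zero_le_one := zero_le
  mul_lt_mul_of_pos_left _ hc _ _ h := Model.mul_lt_mul_left hc h
  mul_lt_mul_of_pos_right c hc a b h := by
    show a * c < b * c
    rw [mul_comm a, mul_comm b]; exact Model.mul_lt_mul_left hc h

theorem Sigma0Pred.le {n : ℕ} {s t : (Fin n → M.N) → M.N} (hs : PolyFun M s)
    (ht : PolyFun M t) : Sigma0Pred M fun x => s x ≤ t x :=
  (Sigma0Pred.lt ht hs).neg.congr fun _ => not_lt.symm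

/-- Every nonempty `Σ⁰₁` class of numbers has a least element. -/
theorem sigma1_least {P : M.N → M.N → Prop}
    (hP : Sigma0Pred M fun x : Fin 3 → M.N => P (x 2) (x 1)) {b : M.N} (hb : ∃ w, P b w) :
    ∃ a, (∃ w, P a w) ∧ a ≤ b ∧ ∀ c, c < a → ∀ w, ¬ P c w := by
  by_contra! H
  -- Without a least element one descends forever: after `x` steps there is an element `y` with `y +
  -- x ≤ b`, which is absurd at `x = b + 1`. In the matrix, variables 0, 1, 2 are `x`, the witness
  -- `w` and `y`, whence the indices in `hP`.
  obtain ⟨w, y, -, hy, -⟩ := sigma1_induction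
    (P := fun x w => ∃ y, y < b + 1 ∧ (y + x ≤ b ∧ P y w))
    (.bex (.const _) (.and (.le (.add (.var _) (.var _)) (.const _)) hP))
    (hb.imp fun w hw => ⟨b, Model.lt_succ_self b, by rw [add_zero], hw⟩)
    (fun x ⟨w, y, _, hyx, hy⟩ => by
      obtain ⟨c, hc, v, hv⟩ := H y ⟨w, hy⟩ (le_self_add.trans hyx)
      have hcx : c + (x + 1) ≤ b :=
        calc c + (x + 1) = c + 1 + x := by ring
          _ ≤ y + x := by gcongr; exact Model.add_one_le_iff.2 hc
          _ ≤ b := hyx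
      exact ⟨v, c, Model.lt_add_one_iff.2 (le_self_add.trans hcx), hcx, hv⟩) (b + 1)
  exact absurd (le_add_self.trans hy) (not_le.2 (Model.lt_succ_self b))

/-- Coded objects bound their components, so the unbounded quantifiers in the definitions of codes,
arcs and compositions are harmless. -/
theorem Sigma0Pred.exists_of_le {n : ℕ} {t : (Fin n → M.N) → M.N} {Q : (Fin n → M.N) → M.N → Prop}
    (ht : PolyFun M t) (hle : ∀ x a, Q x a → a ≤ t x)
    (hQ : Sigma0Pred M fun y : Fin (n + 1) → M.N => Q (Fin.init y) (y (Fin.last n))) :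
    Sigma0Pred M fun x => ∃ a, Q x a :=
  (Sigma0Pred.bex (.add ht (.const 1)) hQ).congr fun x =>
    exists_congr fun a => ⟨fun h => ⟨Model.lt_add_one_iff.2 (hle x a h), h⟩, fun h => h.2⟩

theorem Sigma0Pred.forall_of_le {n : ℕ} {t : (Fin n → M.N) → M.N} {Q : (Fin n → M.N) → M.N → Prop}
    (ht : PolyFun M t) (hle : ∀ x a, ¬ Q x a → a ≤ t x)
    (hQ : Sigma0Pred M fun y : Fin (n + 1) → M.N => Q (Fin.init y) (y (Fin.last n))) :
    Sigma0Pred M fun x => ∀ a, Q x a :=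
  (Sigma0Pred.exists_of_le (Q := fun x a => ¬ Q x a) ht hle hQ.neg).neg.congr fun x => by simp

theorem Sigma0Pred.dvd {n : ℕ} {s t : (Fin n → M.N) → M.N} (hs : PolyFun M s)
    (ht : PolyFun M t) : Sigma0Pred M fun x => s x ∣ t x := by
  refine (Sigma0Pred.bex (t := fun x => t x + 1) (Q := fun x a => t x = s x * a)
    (.add ht (.const 1)) ?_).congr fun x => ⟨?_, fun ⟨c, _, h⟩ => ⟨c, h⟩⟩
  · exact .eq (.lift ht) (.mul (.lift hs) (.var _))
  · rintro ⟨c, hc⟩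
    rcases eq_or_ne (s x) 0 with h0 | h0
    -- With divisor `0` the given quotient need not be bounded, but `0` serves as well.
    · exact ⟨0, Model.lt_add_one_iff.2 zero_le, by rw [hc, h0, zero_mul, zero_mul]⟩
    · refine ⟨c, Model.lt_add_one_iff.2 ?_, hc⟩
      rw [hc]
      exact le_mul_of_one_le_left zero_le (by
        rw [← zero_add (1 : M.N)]; exact Model.add_one_le_iff.2 (pos_iff_ne_zero.2 h0))

/-! ### Pairing -/

def numPair (s t : M.N) : M.N := (s + t) * (s + t) + s

def numTriple (r s t : M.N) : M.N := numPair r (numPair s t)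

theorem PolyFun.numPair {n : ℕ} {s t : (Fin n → M.N) → M.N} (hs : PolyFun M s)
    (ht : PolyFun M t) : PolyFun M fun x => numPair (s x) (t x) :=
  .add (.mul (.add hs ht) (.add hs ht)) hs

theorem PolyFun.numTriple {n : ℕ} {r s t : (Fin n → M.N) → M.N} (hr : PolyFun M r)
    (hs : PolyFun M s) (ht : PolyFun M t) : PolyFun M fun x => numTriple (r x) (s x) (t x) :=
  .numPair hr (.numPair hs ht)

theorem add_le_numPair (s t : M.N) : s + t ≤ numPair s t := by
  unfold numPair
  rcases Model.eq_zero_or_succ (s + t) with h | ⟨c, h⟩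
  · rw [h]; exact zero_le
  · rw [h]; exact (le_mul_of_one_le_left zero_le le_add_self).trans le_self_add

theorem left_le_numPair (s t : M.N) : s ≤ numPair s t := le_self_add.trans (add_le_numPair s t)

theorem right_le_numPair (s t : M.N) : t ≤ numPair s t := le_add_self.trans (add_le_numPair s t)

/-- With `n = s + t`, the value lies between `n²` and `n² + n < (n + 1)²`. Hence a pair determines
its sum, and then its first component. -/
theorem numPair_lt {s t s' t' : M.N} (h : s + t < s' + t') : numPair s t < numPair s' t' := by
  unfold numPair
  calc (s + t) * (s + t) + s ≤ (s + t) * (s + t) + (s + t) := by gcongr; exact le_self_add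
    _ ≤ (s + t) * (s + t) + (s + t) + (s + t) := le_self_add
    _ < (s + t) * (s + t) + (s + t) + (s + t) + 1 := Model.lt_succ_self _
    _ = (s + t + 1) * (s + t + 1) := by ring
    _ ≤ (s' + t') * (s' + t') := 
      mul_le_mul' (Model.add_one_le_iff.2 h) (Model.add_one_le_iff.2 h)
    _ ≤ (s' + t') * (s' + t') + s' := le_self_add

theorem numPair_inj {s t s' t' : M.N} : numPair s t = numPair s' t' ↔ s = s' ∧ t = t' := by
  refine ⟨fun h => ?_, fun h => by rw [h.1, h.2]⟩
  have hst : s + t = s' + t' := by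
    rcases lt_trichotomy (s + t) (s' + t') with h' | h' | h'
    · exact absurd h (numPair_lt h').ne
    · exact h'
    · exact absurd h (numPair_lt h').ne'
  have hs : s = s' := by
    unfold numPair at h
    rw [hst] at h
    exact add_left_cancel h
  subst hs
  exact ⟨rfl, add_left_cancel hst⟩

theorem numTriple_inj {r s t r' s' t' : M.N} :
    numTriple r s t = numTriple r' s' t' ↔ r = r' ∧ s = s' ∧ t = t' := by
  unfold numTriple; rw [numPair_inj, numPair_inj]

theorem fst_le_numTriple (r s t : M.N) : r ≤ numTriple r s t := left_le_numPair _ _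

theorem snd_le_numTriple (r s t : M.N) : s ≤ numTriple r s t :=
  (left_le_numPair _ _).trans (right_le_numPair _ _)

theorem trd_le_numTriple (r s t : M.N) : t ≤ numTriple r s t :=
  (right_le_numPair _ _).trans (right_le_numPair _ _)

theorem numPair_mono {s t s' t' : M.N} (hs : s ≤ s') (ht : t ≤ t') :
    numPair s t ≤ numPair s' t' := by
  unfold numPair; gcongr

theorem numTriple_mono {r s t r' s' t' : M.N} (hr : r ≤ r') (hs : s ≤ s') (ht : t ≤ t') :
    numTriple r s t ≤ numTriple r' s' t' :=
  numPair_mono hr (numPair_mono hs ht)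

/-! ### Coding bounded sets by divisibility -/

def modulus (a i : M.N) : M.N := a * (i + 1) + 1

theorem PolyFun.modulus {n : ℕ} {s t : (Fin n → M.N) → M.N} (hs : PolyFun M s)
    (ht : PolyFun M t) : PolyFun M fun x => modulus (s x) (t x) :=
  .add (.mul hs (.add ht (.const 1))) (.const 1)

theorem Model.dvd_of_dvd_add {a b c : M.N} (hab : a ∣ b + c) (hb : a ∣ b) : a ∣ c := by
  obtain ⟨m, hm⟩ := hab
  obtain ⟨n, rfl⟩ := hb
  rcases eq_or_ne a 0 with rfl | ha
  · rw [zero_mul, zero_mul, zero_add] at hm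
    rw [hm]
  · have hnm : n ≤ m := by
      by_contra! h
      have := Model.mul_lt_mul_left (pos_iff_ne_zero.2 ha) h
      exact absurd (hm ▸ this) (not_lt.2 le_self_add)
    obtain ⟨d, rfl⟩ := exists_add_of_le hnm
    exact ⟨d, add_left_cancel (a := a * n) (by rw [hm]; ring)⟩

/-- Two moduli differ by `a (e + 1)` with `e + 1 ∣ a`, so modulo the `i`-th one `d` is killed by
`a²`; and `a` is invertible there, because `a (i + 1) + 1` vanishes. Subtraction is expressed by
`Model.dvd_of_dvd_add`. -/
theorem dvd_of_dvd_mul_modulus {k a i j d : M.N} (ha : ∀ i, i < k → i + 1 ∣ a) (hi : i < k)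
    (hj : j < k) (hij : i ≠ j) (h : modulus a i ∣ d * modulus a j) : modulus a i ∣ d := by
  have key : ∀ e, e < k → modulus a i ∣ d * (a * (e + 1)) → modulus a i ∣ d := by
    intro e he h
    obtain ⟨c, hc⟩ := ha e he
    have h1 : modulus a i ∣ d * (a * a) := by
      have : d * (a * a) = d * (a * (e + 1)) * c := by
        calc d * (a * a) = d * (a * ((e + 1) * c)) := by rw [← hc]
          _ = _ := by ring
      rw [this]; exact h.mul_right c
    have h2 : modulus a i ∣ d * a := by
      refine Model.dvd_of_dvd_add (b := d * (a * a) * (i + 1)) ?_ (h1.mul_right _)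
      exact ⟨d * a, by unfold modulus; ring⟩
    refine Model.dvd_of_dvd_add (b := d * a * (i + 1)) ?_ (h2.mul_right _)
    exact ⟨d, by unfold modulus; ring⟩
  rcases lt_or_gt_of_ne hij with hlt | hlt
  · obtain ⟨e, rfl⟩ := Model.lt_iff_exists.1 hlt
    refine key e ((Model.lt_succ_self e).trans_le le_add_self |>.trans hj) ?_
    refine Model.dvd_of_dvd_add (b := d * modulus a i) ?_ (Dvd.intro_left _ rfl)
    have : d * modulus a i + d * (a * (e + 1)) = d * modulus a (i + (e + 1)) := by
      unfold modulus; ring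
    rwa [this]
  · obtain ⟨e, rfl⟩ := Model.lt_iff_exists.1 hlt
    refine key e ((Model.lt_succ_self e).trans_le le_add_self |>.trans hi) ?_
    refine Model.dvd_of_dvd_add ?_ h
    exact ⟨d, by unfold modulus; ring⟩

theorem exists_common_multiple {f : M.N → M.N} (hf0 : ∀ i, f i ≠ 0)
    (hf : ∀ {n : ℕ} {t : (Fin n → M.N) → M.N}, PolyFun M t → PolyFun M fun x => f (t x))
    (k : M.N) : ∃ B, 0 < B ∧ ∀ i, i < k → f i ∣ B :=
  sigma1_induction (P := fun k B => 0 < B ∧ ∀ i, i < k → f i ∣ B)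
    (.and (.lt (.const _) (.var _)) (.ball (.var _) (.dvd (hf (.var _)) (.var (1 : Fin 3)))))
    ⟨1, zero_lt_one, fun i hi => (Model.not_lt_zero i hi).elim⟩
    (fun k ⟨B, hB, h⟩ => ⟨B * f k, mul_pos hB (pos_iff_ne_zero.2 (hf0 k)), fun i hi => by
      rcases Model.lt_succ.1 hi with hi | rfl
      · exact (h i hi).mul_right _
      · exact Dvd.intro_left _ rfl⟩) k

/-- `a` is such that the moduli `a (i + 1) + 1`, `i < k`, are independent, and `B` is a common
multiple of them. -/
structure IsBase (k a B : M.N) : Prop where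
  pos : 0 < a
  pos_mul : 0 < B
  dvd : ∀ i, i < k → modulus a i ∣ B
  indep : ∀ i j d, i < k → j < k → i ≠ j → modulus a i ∣ d * modulus a j → modulus a i ∣ d

theorem exists_isBase (k : M.N) : ∃ a B, IsBase k a B := by
  obtain ⟨a, ha, h⟩ := exists_common_multiple (f := fun i : M.N => i + 1)
    Model.succ_ne_zero (fun ht => .add ht (.const 1)) k
  obtain ⟨B, hB, h'⟩ := exists_common_multiple (f := fun i : M.N => modulus a i)
    (fun _ => Model.succ_ne_zero _) (fun ht => .modulus (.const a) ht) k
  exact ⟨a, B, ha, hB, h', fun i j d hi hj => dvd_of_dvd_mul_modulus h hi hj⟩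

/-- Deleting an element from a coded set makes the code smaller; this is what minimality arguments
exploit. -/
theorem IsBase.lt_mul_modulus {k a B c i : M.N} (h : IsBase k a B) (hc : 0 < c) :
    c < c * modulus a i := by
  have h1 : 1 < modulus a i :=
    lt_add_of_pos_left 1 (mul_pos h.pos ((zero_le : 0 ≤ i).trans_lt (Model.lt_succ_self i)))
  simpa using Model.mul_lt_mul_left hc h1

/-- The complement in `[0, k)` of a `Σ⁰₁` class is coded. -/
theorem IsBase.exists_dvd_iff_not {k a B : M.N} (h : IsBase k a B) {θ : M.N → M.N → Prop}
    (hθ : ∀ {n : ℕ} {s t : (Fin n → M.N) → M.N}, PolyFun M s → PolyFun M t →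
      Sigma0Pred M fun x => θ (s x) (t x)) :
    ∃ b, b ≤ B ∧ ∀ i, i < k → (modulus a i ∣ b ↔ ¬ ∃ w, θ i w) := by
  -- Take the least `b` whose moduli cover all `i < k` outside the class. One number `w` bounds all
  -- witnesses used, so the condition is `Σ⁰₁` and no collection principle is invoked.
  obtain ⟨b, ⟨w, hb, hw⟩, hbB, hmin⟩ := sigma1_least
    (P := fun b w => 0 < b ∧ ∀ i, i < k → (modulus a i ∣ b ∨ ∃ v, v < w ∧ θ i v))
    (.and (.lt (.const _) (.var _)) (.ball (.const _) (.or (.dvd (.modulus (.const _) (.var _))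
      (.var (2 : Fin 4))) (.bex (.var (1 : Fin 4)) (hθ (.var (3 : Fin 5)) (.var _))))))
    (b := B) ⟨0, h.pos_mul, fun i hi => .inl (h.dvd i hi)⟩
  refine ⟨b, hbB, fun i hi => ⟨?_, fun hi' => ?_⟩⟩
  · rintro ⟨c, rfl⟩ ⟨v, hv⟩
    rw [mul_comm] at hb hw hmin
    have hc : 0 < c := pos_of_mul_pos_left hb zero_le
    -- If `i` is in the class, its modulus can be divided out once the witness bound exceeds `v`.
    refine hmin c (h.lt_mul_modulus hc) (max w (v + 1)) ⟨hc, fun j hj => ?_⟩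
    by_cases hji : j = i
    · exact .inr ⟨v, lt_max_of_lt_right (Model.lt_succ_self v), hji ▸ hv⟩
    · exact (hw j hj).imp (h.indep j i c hj hi hji)
        fun ⟨v', hv', h'⟩ => ⟨v', lt_max_of_lt_left hv', h'⟩
  · exact (hw i hi).resolve_right fun ⟨v, _, hv⟩ => hi' ⟨v, hv⟩

theorem bounded_sigma1_comprehension (k : M.N) {θ : M.N → M.N → Prop}
    (hθ : ∀ {n : ℕ} {s t : (Fin n → M.N) → M.N}, PolyFun M s → PolyFun M t →
      Sigma0Pred M fun x => θ (s x) (t x)) : {i | i < k ∧ ∃ w, θ i w} ∈ M.sets := by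
  obtain ⟨a, B, h⟩ := exists_isBase k
  obtain ⟨b, -, hb⟩ := h.exists_dvd_iff_not hθ
  convert sigma0_comprehension (P := fun i => i < k ∧ ¬ modulus a i ∣ b)
    (.and (.lt (.var _) (.const _)) (.neg (.dvd (.modulus (.const _) (.var _)) (.const _))))
    using 3 with i
  exact and_congr_right fun hi => by rw [hb i hi, not_not]

/-- A transitive irreflexive `Σ⁰₀` relation has a maximal element in every bounded nonempty
`Σ⁰₁` class. -/
theorem exists_maximal_of_bounded (k : M.N) {A S : M.N → M.N → Prop}
    (hA : ∀ {n : ℕ} {s t : (Fin n → M.N) → M.N}, PolyFun M s → PolyFun M t →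
      Sigma0Pred M fun x => A (s x) (t x))
    (hS : ∀ {n : ℕ} {s t : (Fin n → M.N) → M.N}, PolyFun M s → PolyFun M t →
      Sigma0Pred M fun x => S (s x) (t x))
    (hAk : ∀ x d, A x d → x < k) (hne : ∃ x d, A x d) (hirr : ∀ x, ¬ S x x)
    (htrans : ∀ x y z, S x y → S y z → S x z) :
    ∃ x, (∃ d, A x d) ∧ ∀ y d, A y d → ¬ S x y := by
  obtain ⟨a, B, h⟩ := exists_isBase k
  obtain ⟨x₀, d₀, h₀⟩ := hne
  -- Choose `x` in the class so that a number divisible by the moduli of all its successors is as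
  -- small as possible. If `y` were a successor of `x` in the class, its own successors would be
  -- successors of `x` other than `y`, so the modulus of `y` could be divided out.
  obtain ⟨b, ⟨d, hb, x, hxk, hxd, hx⟩, -, hmin⟩ := sigma1_least
    (P := fun b d => 0 < b ∧ ∃ x, x < k ∧ (A x d ∧ ∀ z, z < k → (S x z → modulus a z ∣ b)))
    (.and (.lt (.const _) (.var _)) (.bex (.const _) (.and (hA (.var _) (.var (1 : Fin 4)))
      (.ball (.const _) (.imp (hS (.var (3 : Fin 5)) (.var _))
        (.dvd (.modulus (.const _) (.var _)) (.var (2 : Fin 5))))))))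
    (b := B) ⟨d₀, h.pos_mul, x₀, hAk _ _ h₀, h₀, fun z hz _ => h.dvd z hz⟩
  refine ⟨x, ⟨d, hxd⟩, fun y e hye hxy => ?_⟩
  have hyk := hAk y e hye
  obtain ⟨c, rfl⟩ := hx y hyk hxy
  rw [mul_comm] at hb hx hmin
  have hc : 0 < c := pos_of_mul_pos_left hb zero_le
  refine hmin c (h.lt_mul_modulus hc) e ⟨hc, y, hyk, hye, fun z hz hyz => ?_⟩
  exact h.indep z y c hz hyk (fun e => hirr y (e ▸ hyz)) (hx z hz (htrans x y z hxy hyz))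

/-! ### Codes of finite sets -/

/-- `i` is an element of the finite set with code `c`. -/
def Mem (i c : M.N) : Prop :=
  ∃ k a b, c = numTriple k a b ∧ i < k ∧ a * (i + 1) + 1 ∣ b

theorem mem_numTriple {i k a b : M.N} : Mem i (numTriple k a b) ↔ i < k ∧ modulus a i ∣ b := by
  refine ⟨?_, fun h => ⟨k, a, b, rfl, h⟩⟩
  rintro ⟨k', a', b', h, h'⟩
  obtain ⟨rfl, rfl, rfl⟩ := numTriple_inj.1 h
  exact h'

theorem Mem.lt {i c : M.N} : Mem i c → i < c := by
  rintro ⟨k, a, b, rfl, h, -⟩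
  exact h.trans_le (fst_le_numTriple k a b)

theorem Sigma0Pred.memCode {n : ℕ} {s t : (Fin n → M.N) → M.N} (hs : PolyFun M s)
    (ht : PolyFun M t) : Sigma0Pred M fun x => Mem (s x) (t x) := by
  refine .exists_of_le ht ?_ (.exists_of_le (.lift ht) ?_ (.exists_of_le (.lift (.lift ht)) ?_
    (.and (.eq (.lift (.lift (.lift ht))) (.numTriple (.var _) (.var _) (.var _)))
    (.and (.lt (.lift (.lift (.lift hs))) (.var _))
      (.dvd (.add (.mul (.var _) (.add (.lift (.lift (.lift hs))) (.const 1))) (.const 1))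
        (.var _))))))
  · rintro x k ⟨a, b, h, -⟩
    rw [h]; exact fst_le_numTriple _ _ _
  · rintro x a ⟨b, h, -⟩
    show a ≤ t (Fin.init x)
    rw [h]; exact snd_le_numTriple _ _ _
  · rintro x b ⟨h, -⟩
    show b ≤ t (Fin.init (Fin.init x))
    rw [h]; exact trd_le_numTriple _ _ _

/-- All subsets of `[0, k)` are coded over one base `(a, B)` with `b ≤ B`, so the bound `u` does not
depend on `φ`. -/
theorem exists_code_lt (k : M.N) : ∃ u, ∀ φ : M.N → Prop,
    (∀ {n : ℕ} {t : (Fin n → M.N) → M.N}, PolyFun M t → Sigma0Pred M fun x => φ (t x)) →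
    ∃ c, c < u ∧ (∃ l a b, c = numTriple l a b) ∧ ∀ i, Mem i c ↔ i < k ∧ φ i := by
  obtain ⟨a, B, h⟩ := exists_isBase k
  refine ⟨numTriple k a B + 1, fun φ hφ => ?_⟩
  obtain ⟨b, hbB, hb⟩ := h.exists_dvd_iff_not (θ := fun i _ => ¬ φ i) fun hs _ => .neg (hφ hs)
  refine ⟨numTriple k a b, Model.lt_add_one_iff.2 (numTriple_mono le_rfl le_rfl hbB),
    ⟨k, a, b, rfl⟩, fun i => ?_⟩
  rw [mem_numTriple]
  exact and_congr_right fun hi => by rw [hb i hi]; simp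

/-! ### Size-change graphs in a model -/

def Src (G f : M.N) : Prop := ∃ g e, G = numTriple f g e

def Tgt (G g : M.N) : Prop := ∃ f e, G = numTriple f g e

def Arc (G x r y : M.N) : Prop := ∃ f g e, G = numTriple f g e ∧ Mem (numTriple x r y) e

def AnyArc (G x y : M.N) : Prop := Arc G x 0 y ∨ Arc G x 1 y

theorem Src.unique {G f f' : M.N} : Src G f → Src G f' → f = f' := by
  rintro ⟨g, e, rfl⟩ ⟨g', e', h⟩
  exact (numTriple_inj.1 h).1

theorem Tgt.unique {G f f' : M.N} : Tgt G f → Tgt G f' → f = f' := by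
  rintro ⟨g, e, rfl⟩ ⟨g', e', h⟩
  exact (numTriple_inj.1 h).2.1

theorem arc_numTriple {f g e x r y : M.N} :
    Arc (numTriple f g e) x r y ↔ Mem (numTriple x r y) e := by
  refine ⟨?_, fun h => ⟨f, g, e, rfl, h⟩⟩
  rintro ⟨f', g', e', h, h'⟩
  obtain ⟨rfl, rfl, rfl⟩ := numTriple_inj.1 h
  exact h'

theorem Src.le {G f : M.N} : Src G f → f ≤ G := by
  rintro ⟨g, e, rfl⟩; exact fst_le_numTriple _ _ _

theorem Tgt.le {G f : M.N} : Tgt G f → f ≤ G := by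
  rintro ⟨g, e, rfl⟩; exact snd_le_numTriple _ _ _

theorem Arc.left_lt {G x r y : M.N} : Arc G x r y → x < G := by
  rintro ⟨f, g, e, rfl, h⟩
  exact (fst_le_numTriple x r y).trans_lt (h.lt.trans_le (trd_le_numTriple _ _ _))

theorem Arc.right_lt {G x r y : M.N} : Arc G x r y → y < G := by
  rintro ⟨f, g, e, rfl, h⟩
  exact (trd_le_numTriple x r y).trans_lt (h.lt.trans_le (trd_le_numTriple _ _ _))

theorem AnyArc.left_lt {G x y : M.N} (h : AnyArc G x y) : x < G :=
  h.elim Arc.left_lt Arc.left_lt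

theorem AnyArc.right_lt {G x y : M.N} (h : AnyArc G x y) : y < G :=
  h.elim Arc.right_lt Arc.right_lt

section Definability

variable {n : ℕ} {q r s t : (Fin n → M.N) → M.N}

theorem Sigma0Pred.src (hs : PolyFun M s) (ht : PolyFun M t) :
    Sigma0Pred M fun x => Src (s x) (t x) := by
  refine .exists_of_le hs ?_ (.exists_of_le (.lift hs) ?_
    (.eq (.lift (.lift hs)) (.numTriple (.lift (.lift ht)) (.var _) (.var _))))
  · rintro x g ⟨e, h⟩
    rw [h]; exact snd_le_numTriple _ _ _
  · intro x e h
    rw [h]; exact trd_le_numTriple _ _ _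

theorem Sigma0Pred.tgt (hs : PolyFun M s) (ht : PolyFun M t) :
    Sigma0Pred M fun x => Tgt (s x) (t x) := by
  refine .exists_of_le hs ?_ (.exists_of_le (.lift hs) ?_
    (.eq (.lift (.lift hs)) (.numTriple (.var _) (.lift (.lift ht)) (.var _))))
  · rintro x g ⟨e, h⟩
    rw [h]; exact fst_le_numTriple _ _ _
  · intro x e h
    rw [h]; exact trd_le_numTriple _ _ _

theorem Sigma0Pred.arc (hq : PolyFun M q) (hr : PolyFun M r) (hs : PolyFun M s)
    (ht : PolyFun M t) : Sigma0Pred M fun x => Arc (q x) (r x) (s x) (t x) := by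
  refine .exists_of_le hq ?_ (.exists_of_le (.lift hq) ?_ (.exists_of_le (.lift (.lift hq)) ?_
    (.and (.eq (.lift (.lift (.lift hq))) (.numTriple (.var _) (.var _) (.var _)))
      (.memCode (.numTriple (.lift (.lift (.lift hr))) (.lift (.lift (.lift hs)))
        (.lift (.lift (.lift ht)))) (.var _)))))
  · rintro x f ⟨g, e, h, -⟩
    rw [h]; exact fst_le_numTriple _ _ _
  · rintro x g ⟨e, h, -⟩
    rw [h]; exact snd_le_numTriple _ _ _
  · rintro x e ⟨h, -⟩
    rw [h]; exact trd_le_numTriple _ _ _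

theorem Sigma0Pred.anyArc (hq : PolyFun M q) (hr : PolyFun M r) (hs : PolyFun M s) :
    Sigma0Pred M fun x => AnyArc (q x) (r x) (s x) :=
  .or (.arc hq hr (.const 0) hs) (.arc hq hr (.const 1) hs)

end Definability

/-! ### Composition of graphs -/

/-- The composition of two graphs has an arc from `x` to `z`. -/
def AnyStep (G₀ G₁ x z : M.N) : Prop := ∃ y, AnyArc G₀ x y ∧ AnyArc G₁ y z

/-- The composition of two graphs has a strict arc from `x` to `z`. -/
def StrictStep (G₀ G₁ x z : M.N) : Prop :=
  ∃ y, (Arc G₀ x 0 y ∧ AnyArc G₁ y z) ∨ (AnyArc G₀ x y ∧ Arc G₁ y 0 z)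

theorem StrictStep.anyStep {G₀ G₁ x z : M.N} : StrictStep G₀ G₁ x z → AnyStep G₀ G₁ x z := by
  rintro ⟨y, ⟨h, h'⟩ | ⟨h, h'⟩⟩
  · exact ⟨y, .inl h, h'⟩
  · exact ⟨y, h, .inl h'⟩

/-- `H` has the source, the target and the arcs of `G₀; G₁`. -/
def IsComposition (G₀ G₁ H : M.N) : Prop :=
  (∃ f, Src G₀ f ∧ Src H f) ∧ (∃ g, Tgt G₀ g ∧ Src G₁ g) ∧ (∃ h, Tgt G₁ h ∧ Tgt H h) ∧
    ∀ x z, (Arc H x 0 z ↔ StrictStep G₀ G₁ x z) ∧ (AnyArc H x z ↔ AnyStep G₀ G₁ x z)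

/-- Under either bracketing an arc is a path of three arcs, strict if one of the three is strict. -/
theorem IsComposition.assoc {K H₁ H₂ K₁ H L : M.N} (h₁ : IsComposition K H₁ K₁)
    (h₂ : IsComposition H₁ H₂ H) (h : IsComposition K H L) : IsComposition K₁ H₂ L := by
  obtain ⟨⟨f, hf, hf'⟩, ⟨g, hg, hg'⟩, ⟨i, hi, hi'⟩, hK₁⟩ := h₁
  obtain ⟨⟨f₂, hf₂, hf₂'⟩, ⟨g₂, hg₂, hg₂'⟩, ⟨i₂, hi₂, hi₂'⟩, hH⟩ := h₂
  obtain ⟨⟨f₃, hf₃, hf₃'⟩, -, ⟨i₃, hi₃, hi₃'⟩, hL⟩ := h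
  refine ⟨⟨f, hf', hf.unique hf₃ ▸ hf₃'⟩, ⟨g₂, hi.unique hg₂ ▸ hi', hg₂'⟩,
    ⟨i₂, hi₂, hi₂'.unique hi₃ ▸ hi₃'⟩, fun x z => ⟨(hL x z).1.trans ⟨?_, ?_⟩,
      (hL x z).2.trans ⟨?_, ?_⟩⟩⟩
  · rintro ⟨y, ⟨hxy, hyz⟩ | ⟨hxy, hyz⟩⟩
    · obtain ⟨w, hyw, hwz⟩ := (hH y z).2.1 hyz
      exact ⟨w, .inl ⟨(hK₁ x w).1.2 ⟨y, .inl ⟨hxy, hyw⟩⟩, hwz⟩⟩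
    · obtain ⟨w, ⟨hyw, hwz⟩ | ⟨hyw, hwz⟩⟩ := (hH y z).1.1 hyz
      · exact ⟨w, .inl ⟨(hK₁ x w).1.2 ⟨y, .inr ⟨hxy, hyw⟩⟩, hwz⟩⟩
      · exact ⟨w, .inr ⟨(hK₁ x w).2.2 ⟨y, hxy, hyw⟩, hwz⟩⟩
  · rintro ⟨w, ⟨hxw, hwz⟩ | ⟨hxw, hwz⟩⟩
    · obtain ⟨y, ⟨hxy, hyw⟩ | ⟨hxy, hyw⟩⟩ := (hK₁ x w).1.1 hxw
      · exact ⟨y, .inl ⟨hxy, (hH y z).2.2 ⟨w, hyw, hwz⟩⟩⟩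
      · exact ⟨y, .inr ⟨hxy, (hH y z).1.2 ⟨w, .inl ⟨hyw, hwz⟩⟩⟩⟩
    · obtain ⟨y, hxy, hyw⟩ := (hK₁ x w).2.1 hxw
      exact ⟨y, .inr ⟨hxy, (hH y z).1.2 ⟨w, .inr ⟨hyw, hwz⟩⟩⟩⟩
  · rintro ⟨y, hxy, hyz⟩
    obtain ⟨w, hyw, hwz⟩ := (hH y z).2.1 hyz
    exact ⟨w, (hK₁ x w).2.2 ⟨y, hxy, hyw⟩, hwz⟩
  · rintro ⟨w, hxw, hwz⟩
    obtain ⟨y, hxy, hyw⟩ := (hK₁ x w).2.1 hxw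
    exact ⟨y, hxy, (hH y z).2.2 ⟨w, hyw, hwz⟩⟩

/-- Source, target and parameters of `H` are less than `b`. -/
def BoundedBy (b H : M.N) : Prop :=
  (∀ f, Src H f → f < b) ∧ (∀ g, Tgt H g → g < b) ∧ ∀ x z, AnyArc H x z → x < b ∧ z < b

theorem IsComposition.boundedBy {b G₀ G₁ H : M.N} (h : IsComposition G₀ G₁ H)
    (h₀ : BoundedBy b G₀) (h₁ : BoundedBy b G₁) : BoundedBy b H := by
  obtain ⟨⟨f, hf, hf'⟩, -, ⟨i, hi, hi'⟩, hH⟩ := h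
  refine ⟨fun f' h => hf'.unique h ▸ h₀.1 f hf, fun i' h => hi'.unique h ▸ h₁.2.1 i hi,
    fun x z h => ?_⟩
  obtain ⟨y, hxy, hyz⟩ := (hH x z).2.1 h
  exact ⟨(h₀.2.2 x y hxy).1, (h₁.2.2 y z hyz).2⟩

theorem boundedBy_of_lt {b H : M.N} (h : H < b) : BoundedBy b H :=
  ⟨fun _ hf => hf.le.trans_lt h, fun _ hf => hf.le.trans_lt h,
    fun _ _ hx => ⟨hx.left_lt.trans h, hx.right_lt.trans h⟩⟩

section Definability

variable {n : ℕ} {r s t : (Fin n → M.N) → M.N}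

theorem Sigma0Pred.anyStep {q : (Fin n → M.N) → M.N} (hq : PolyFun M q) (hr : PolyFun M r)
    (hs : PolyFun M s) (ht : PolyFun M t) :
    Sigma0Pred M fun x => AnyStep (q x) (r x) (s x) (t x) :=
  .exists_of_le hq (fun _ _ h => h.1.right_lt.le)
    (.and (.anyArc (.lift hq) (.lift hs) (.var _)) (.anyArc (.lift hr) (.var _) (.lift ht)))

theorem Sigma0Pred.strictStep {q : (Fin n → M.N) → M.N} (hq : PolyFun M q) (hr : PolyFun M r)
    (hs : PolyFun M s) (ht : PolyFun M t) :
    Sigma0Pred M fun x => StrictStep (q x) (r x) (s x) (t x) :=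
  .exists_of_le hq (fun _ _ h => h.elim (fun h => h.1.right_lt.le) fun h => h.1.right_lt.le)
    (.or (.and (.arc (.lift hq) (.lift hs) (.const 0) (.var _))
        (.anyArc (.lift hr) (.var _) (.lift ht)))
      (.and (.anyArc (.lift hq) (.lift hs) (.var _))
        (.arc (.lift hr) (.var _) (.const 0) (.lift ht))))

theorem Sigma0Pred.isComposition (hr : PolyFun M r) (hs : PolyFun M s) (ht : PolyFun M t) :
    Sigma0Pred M fun x => IsComposition (r x) (s x) (t x) := by
  -- A failure at `x, z` forces an arc on one of the two sides, and arcs bound their endpoints; this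
  -- makes the universal quantifiers bounded.
  have key : ∀ G₀ G₁ H x z : M.N, ¬ ((Arc H x 0 z ↔ StrictStep G₀ G₁ x z) ∧
      (AnyArc H x z ↔ AnyStep G₀ G₁ x z)) → x ≤ H + G₀ + G₁ ∧ z ≤ H + G₀ + G₁ := by
    intro G₀ G₁ H x z h
    have h' : AnyArc H x z ∨ AnyStep G₀ G₁ x z := by
      by_contra! hc
      exact h ⟨iff_of_false (fun h => hc.1 (.inl h)) fun h => hc.2 h.anyStep,
        iff_of_false hc.1 hc.2⟩
    rcases h' with h' | ⟨y, hxy, hyz⟩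
    · exact ⟨h'.left_lt.le.trans (le_self_add.trans le_self_add),
        h'.right_lt.le.trans (le_self_add.trans le_self_add)⟩
    · exact ⟨hxy.left_lt.le.trans (le_add_self.trans le_self_add),
        hyz.right_lt.le.trans le_add_self⟩
  refine .and ?_ (.and ?_ (.and ?_ ?_))
  · exact .exists_of_le hr (fun _ _ h => h.1.le)
      (.and (.src (.lift hr) (.var _)) (.src (.lift ht) (.var _)))
  · exact .exists_of_le hr (fun _ _ h => h.1.le)
      (.and (.tgt (.lift hr) (.var _)) (.src (.lift hs) (.var _)))
  · exact .exists_of_le hs (fun _ _ h => h.1.le)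
      (.and (.tgt (.lift hs) (.var _)) (.tgt (.lift ht) (.var _)))
  · refine .forall_of_le (.add (.add ht hr) hs) ?_ (.forall_of_le
      (.lift (.add (.add ht hr) hs)) ?_ (.and
        (.iff (.arc (.lift (.lift ht)) (.var _) (.const 0) (.var _))
          (.strictStep (.lift (.lift hr)) (.lift (.lift hs)) (.var _) (.var _)))
        (.iff (.anyArc (.lift (.lift ht)) (.var _) (.var _))
          (.anyStep (.lift (.lift hr)) (.lift (.lift hs)) (.var _) (.var _)))))
    · intro x a h
      obtain ⟨z, hz⟩ := not_forall.1 h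
      exact (key _ _ _ _ _ hz).1
    · intro x a h
      exact (key _ _ _ _ _ h).2

theorem Sigma0Pred.boundedBy (hs : PolyFun M s) (ht : PolyFun M t) :
    Sigma0Pred M fun x => BoundedBy (s x) (t x) := by
  refine .and ?_ (.and ?_ ?_)
  · exact .forall_of_le ht (fun _ _ h => (Classical.not_imp.1 h).1.le)
      (.imp (.src (.lift ht) (.var _)) (.lt (.var _) (.lift hs)))
  · exact .forall_of_le ht (fun _ _ h => (Classical.not_imp.1 h).1.le)
      (.imp (.tgt (.lift ht) (.var _)) (.lt (.var _) (.lift hs)))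
  · refine .forall_of_le ht (fun x a h => ?_) (.forall_of_le (.lift ht) (fun x a h => ?_)
      (.imp (.anyArc (.lift (.lift ht)) (.var _) (.var _))
        (.and (.lt (.var _) (.lift (.lift hs))) (.lt (.var _) (.lift (.lift hs))))))
    · obtain ⟨z, hz⟩ := not_forall.1 h
      exact (Classical.not_imp.1 hz).1.left_lt.le
    · exact (Classical.not_imp.1 h).1.right_lt.le

end Definability

/-! ### Bounds on codes of graphs -/

/-- `c` is the least triple coding its set of elements. -/
def IsCode (c : M.N) : Prop :=
  (∃ k a b, c = numTriple k a b) ∧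
    ∀ d, (∃ k a b, d = numTriple k a b) ∧ (∀ i, Mem i c ↔ Mem i d) → ¬ d < c

/-- The set of edges of `G` is given by its code and consists of labelled arcs. -/
def IsRawGraph (G : M.N) : Prop :=
  ∃ f g e, G = numTriple f g e ∧ IsCode e ∧
    ∀ p, Mem p e → ∃ x r y, p = numTriple x r y ∧ (r = 0 ∨ r = 1)

/-- The first bound rests on minimality of codes: an edge set inside a fixed interval has some code
below a uniform bound, hence so has its least code. The second part supplies intermediate
compositions for associativity. -/
theorem exists_graph_bound (b : M.N) : ∃ u,
    (∀ H, BoundedBy b H → IsRawGraph H → H < u) ∧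
    ∀ G₀ G₁ g, BoundedBy b G₀ → BoundedBy b G₁ → Tgt G₀ g → Src G₁ g →
      ∃ H, H < u ∧ IsComposition G₀ G₁ H := by
  have hk : ∀ x r z : M.N, x < b → z < b → (r = 0 ∨ r = 1) →
      numTriple x r z < numTriple b 1 b + 1 := by
    intro x r z hx hz hr
    refine Model.lt_add_one_iff.2 (numTriple_mono hx.le ?_ hz.le)
    rcases hr with rfl | rfl
    · exact zero_le
    · exact le_rfl
  obtain ⟨u, hu⟩ := exists_code_lt (numTriple b 1 b + 1)
  refine ⟨numTriple b b u + 1, fun H hb ⟨f, g, e, hH, he, hp⟩ => ?_,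
    fun G₀ G₁ g h₀ h₁ hg hg' => ?_⟩
  · obtain ⟨c, hcu, hc, hce⟩ := hu (fun p => Mem p e) fun ht => .memCode ht (.const e)
    have hec : e ≤ c := not_lt.1 <| he.2 c ⟨hc, fun p => by
      rw [hce]
      refine ⟨fun h => ⟨?_, h⟩, fun h => h.2⟩
      obtain ⟨x, r, y, rfl, hr⟩ := hp p h
      have harc : AnyArc H x y := by
        unfold AnyArc
        rw [hH, arc_numTriple, arc_numTriple]
        rcases hr with rfl | rfl
        · exact .inl h
        · exact .inr h
      exact hk x r y (hb.2.2 x y harc).1 (hb.2.2 x y harc).2 hr⟩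
    rw [hH]
    exact Model.lt_add_one_iff.2 (numTriple_mono (hb.1 f ⟨g, e, hH⟩).le (hb.2.1 g ⟨f, e, hH⟩).le
      (hec.trans hcu.le))
  · obtain ⟨f, g₁, e, hf⟩ : ∃ f g e, G₀ = numTriple f g e := by
      obtain ⟨f, e, h⟩ := hg; exact ⟨f, g, e, h⟩
    obtain ⟨g₂, i, e', hi⟩ : ∃ g i e, G₁ = numTriple g i e := ⟨g, hg'⟩
    -- A strict step contributes both labels here. The result need not be a size-change graph in the
    -- official sense, but `IsComposition` looks only at strict arcs and at arcs of either label.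
    obtain ⟨c, hcu, hc, hce⟩ := hu (fun p => (∃ x z, p = numTriple x 0 z ∧ StrictStep G₀ G₁ x z) ∨
        ∃ x z, p = numTriple x 1 z ∧ AnyStep G₀ G₁ x z) fun ht => by
      refine .or ?_ ?_
      · exact .exists_of_le ht (fun _ _ ⟨_, h⟩ => h.1 ▸ fst_le_numTriple _ _ _)
          (.exists_of_le (.lift ht) (fun _ _ h => h.1 ▸ trd_le_numTriple _ _ _)
            (.and (.eq (.lift (.lift ht)) (.numTriple (.var _) (.const 0) (.var _)))
              (.strictStep (.const _) (.const _) (.var _) (.var _))))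
      · exact .exists_of_le ht (fun _ _ ⟨_, h⟩ => h.1 ▸ fst_le_numTriple _ _ _)
          (.exists_of_le (.lift ht) (fun _ _ h => h.1 ▸ trd_le_numTriple _ _ _)
            (.and (.eq (.lift (.lift ht)) (.numTriple (.var _) (.const 1) (.var _)))
              (.anyStep (.const _) (.const _) (.var _) (.var _))))
    have hb : ∀ x z, AnyStep G₀ G₁ x z → x < b ∧ z < b := fun x z ⟨y, hxy, hyz⟩ =>
      ⟨(h₀.2.2 _ _ hxy).1, (h₁.2.2 _ _ hyz).2⟩
    have hs : ∀ x z, Arc (numTriple f i c) x 0 z ↔ StrictStep G₀ G₁ x z := by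
      intro x z
      rw [arc_numTriple, hce]
      constructor
      · rintro ⟨-, ⟨x', z', h, h'⟩ | ⟨x', z', h, -⟩⟩
        · obtain ⟨rfl, -, rfl⟩ := numTriple_inj.1 h
          exact h'
        · exact absurd (numTriple_inj.1 h).2.1 zero_ne_one
      · intro h
        exact ⟨hk _ _ _ (hb x z h.anyStep).1 (hb x z h.anyStep).2 (.inl rfl),
          .inl ⟨x, z, rfl, h⟩⟩
    have ha : ∀ x z, AnyArc (numTriple f i c) x z ↔ AnyStep G₀ G₁ x z := by
      intro x z
      unfold AnyArc
      rw [hs, arc_numTriple, hce]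
      constructor
      · rintro (h | ⟨-, ⟨x', z', h, -⟩ | ⟨x', z', h, h'⟩⟩)
        · exact h.anyStep
        · exact absurd (numTriple_inj.1 h).2.1 one_ne_zero
        · obtain ⟨rfl, -, rfl⟩ := numTriple_inj.1 h
          exact h'
      · intro h
        exact .inr ⟨hk _ _ _ (hb x z h).1 (hb x z h).2 (.inr rfl), .inr ⟨x, z, rfl, h⟩⟩
    refine ⟨numTriple f i c, Model.lt_add_one_iff.2 (numTriple_mono ?_ ?_ hcu.le),
      ⟨f, ⟨_, _, hf⟩, ⟨_, _, rfl⟩⟩, ⟨g, hg, hg'⟩, ⟨i, ⟨_, _, hi⟩, ⟨_, _, rfl⟩⟩,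
      fun x z => ⟨hs x z, ha x z⟩⟩
    · exact (h₀.1 f ⟨_, _, hf⟩).le
    · exact (h₁.2.1 i ⟨_, _, hi⟩).le

/-! ### Derivations in the closure -/

/-- `s` codes a sequence of pairs `(gᵢ, cᵢ)`, `i ≤ l`, such that `gᵢ ∈ 𝒢`, `c₀ = g₀`,
`cᵢ₊₁ = cᵢ; gᵢ₊₁` and `c_l = H`. -/
def IsDerivation (𝒢 : Set M.N) (s l H : M.N) : Prop :=
  (∀ i g c, Mem (numTriple i g c) s → (i ≤ l ∧ g ∈ 𝒢) ∧ (i = 0 → g = c) ∧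
    (∀ g' c', Mem (numTriple i g' c') s → g' = g ∧ c' = c) ∧
    ∀ g' c', Mem (numTriple (i + 1) g' c') s → IsComposition c g' c') ∧
  (∀ i, i < l + 1 → ∃ g c, Mem (numTriple i g c) s) ∧ ∃ g, Mem (numTriple l g H) s

theorem Mem.fst_le {i g c s : M.N} (h : Mem (numTriple i g c) s) : i ≤ s :=
  (fst_le_numTriple i g c).trans h.lt.le

theorem Mem.snd_le {i g c s : M.N} (h : Mem (numTriple i g c) s) : g ≤ s :=
  (snd_le_numTriple i g c).trans h.lt.le

theorem Mem.trd_le {i g c s : M.N} (h : Mem (numTriple i g c) s) : c ≤ s :=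
  (trd_le_numTriple i g c).trans h.lt.le

section Definability

variable {n : ℕ} {r s t : (Fin n → M.N) → M.N}

theorem Sigma0Pred.forall_entry {Q : (Fin n → M.N) → M.N → M.N → Prop} (hr : PolyFun M r)
    (hs : PolyFun M s) (hQ : Sigma0Pred M fun y : Fin (n + 1 + 1) → M.N =>
      Q (Fin.init (Fin.init y)) (y (Fin.last n).castSucc) (y (Fin.last (n + 1)))) :
    Sigma0Pred M fun x => ∀ g c, Mem (numTriple (r x) g c) (s x) → Q x g c := by
  refine .forall_of_le hs (fun x g h => ?_) (.forall_of_le (.lift hs) (fun x c h => ?_)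
    (.imp (.memCode (.numTriple (.lift (.lift hr)) (.var _) (.var _)) (.lift (.lift hs))) hQ))
  · obtain ⟨z, hz⟩ := not_forall.1 h
    exact (Classical.not_imp.1 hz).1.snd_le
  · exact (Classical.not_imp.1 h).1.trd_le

theorem Sigma0Pred.exists_entry (hr : PolyFun M r)
    (hs : PolyFun M s) : Sigma0Pred M fun x => ∃ g c, Mem (numTriple (r x) g c) (s x) :=
  .exists_of_le hs (fun _ _ ⟨_, h⟩ => h.snd_le) (.exists_of_le (.lift hs) (fun _ _ h => h.trd_le)
    (.memCode (.numTriple (.lift (.lift hr)) (.var _) (.var _)) (.lift (.lift hs))))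

theorem Sigma0Pred.isDerivation {𝒢 : Set M.N} (h𝒢 : 𝒢 ∈ M.sets) (hr : PolyFun M r)
    (hs : PolyFun M s) (ht : PolyFun M t) :
    Sigma0Pred M fun x => IsDerivation 𝒢 (r x) (s x) (t x) := by
  refine .and (.forall_of_le hr (fun x i h => ?_) (.forall_entry (.var _) (.lift hr)
    (.and (.and (.le (.var _) (.lift (.lift (.lift hs)))) (.mem (.var _) h𝒢))
      (.and (.imp (.eq (.var _) (.const 0)) (.eq (.var _) (.var _)))
        (.and (.forall_entry (.var _) (.lift (.lift (.lift hr)))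
            (.and (.eq (.var _) (.var _)) (.eq (.var _) (.var _))))
          (.forall_entry (.add (.var _) (.const 1)) (.lift (.lift (.lift hr)))
            (.isComposition (.var _) (.var _) (.var _))))))))
    (.and (.ball (.add hs (.const 1)) (.exists_entry (.var _) (.lift hr)))
      (.exists_of_le hr (fun _ _ h => h.snd_le)
        (.memCode (.numTriple (.lift hs) (.var _) (.lift ht)) (.lift hr))))
  obtain ⟨g, hg⟩ := not_forall.1 h
  obtain ⟨c, hc⟩ := not_forall.1 hg
  exact (Classical.not_imp.1 hc).1.fst_le

end Definability

theorem exists_code_of_bounded (k : M.N) {φ : M.N → Prop}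
    (hφ : ∀ {n : ℕ} {t : (Fin n → M.N) → M.N}, PolyFun M t → Sigma0Pred M fun x => φ (t x))
    (hk : ∀ p, φ p → p < k) : ∃ c, ∀ p, Mem p c ↔ φ p := by
  obtain ⟨u, hu⟩ := exists_code_lt k
  obtain ⟨c, -, -, hc⟩ := hu φ hφ
  exact ⟨c, fun p => by rw [hc]; exact ⟨fun h => h.2, fun h => ⟨hk p h, h⟩⟩⟩

theorem exists_isDerivation_of_mem {𝒢 : Set M.N} {G : M.N} (hG : G ∈ 𝒢) :
    ∃ s, IsDerivation 𝒢 s 0 G := by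
  obtain ⟨s, hs⟩ := exists_code_of_bounded (numTriple 0 G G + 1) (φ := fun p => p = numTriple 0 G G)
    (fun ht => .eq ht (.const _)) (fun p hp => hp ▸ Model.lt_succ_self _)
  refine ⟨s, fun i g c h => ?_, fun i hi => ⟨G, G, ?_⟩, G, (hs _).2 rfl⟩
  · obtain ⟨rfl, rfl, rfl⟩ := numTriple_inj.1 ((hs _).1 h)
    refine ⟨⟨le_rfl, hG⟩, fun _ => rfl, fun g' c' h' => (numTriple_inj.1 ((hs _).1 h')).2,
      fun g' c' h' => ?_⟩
    exact absurd (numTriple_inj.1 ((hs _).1 h')).1 (Model.succ_ne_zero _)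
  · rw [hs, numTriple_inj]
    exact ⟨le_antisymm (Model.lt_add_one_iff.1 (by simpa using hi)) zero_le, rfl, rfl⟩

theorem IsDerivation.exists_append {𝒢 : Set M.N} {s l H g L : M.N} (h : IsDerivation 𝒢 s l H)
    (hg : g ∈ 𝒢) (hL : IsComposition H g L) : ∃ s', IsDerivation 𝒢 s' (l + 1) L := by
  obtain ⟨s', hs'⟩ := exists_code_of_bounded (max s (numTriple (l + 1) g L + 1))
    (φ := fun p => Mem p s ∨ p = numTriple (l + 1) g L)
    (fun ht => .or (.memCode ht (.const _)) (.eq ht (.const _))) (fun p hp => by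
      rcases hp with hp | rfl
      · exact lt_max_of_lt_left hp.lt
      · exact lt_max_of_lt_right (Model.lt_succ_self _))
  obtain ⟨h₁, h₂, g₀, h₃⟩ := h
  have hnew : ∀ {g' c'}, ¬ Mem (numTriple (l + 1) g' c') s := fun h =>
    absurd (h₁ _ _ _ h).1.1 (not_le.2 (Model.lt_succ_self l))
  refine ⟨s', fun i g' c' h => ?_, fun i hi => ?_, g, (hs' _).2 (.inr rfl)⟩
  · rcases (hs' _).1 h with h | h
    · obtain ⟨⟨hil, hg'⟩, h0, hu, hc⟩ := h₁ i g' c' h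
      refine ⟨⟨hil.trans le_self_add, hg'⟩, h0, fun g₁ c₁ h₄ => ?_, fun g₁ c₁ h₄ => ?_⟩
      · rcases (hs' _).1 h₄ with h₄ | h₄
        · exact hu _ _ h₄
        · obtain ⟨rfl, -⟩ := numTriple_inj.1 h₄
          exact (hnew h).elim
      · rcases (hs' _).1 h₄ with h₄ | h₄
        · exact hc _ _ h₄
        · obtain ⟨hi, rfl, rfl⟩ := numTriple_inj.1 h₄
          obtain rfl := add_right_cancel hi
          obtain ⟨-, rfl⟩ := hu _ _ h₃
          exact hL
    · obtain ⟨rfl, rfl, rfl⟩ := numTriple_inj.1 h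
      refine ⟨⟨le_rfl, hg⟩, fun h => (Model.succ_ne_zero _ h).elim, fun g₁ c₁ h₄ => ?_,
        fun g₁ c₁ h₄ => ?_⟩
      · rcases (hs' _).1 h₄ with h₄ | h₄
        · exact (hnew h₄).elim
        · exact (numTriple_inj.1 h₄).2
      · rcases (hs' _).1 h₄ with h₄ | h₄
        · exact absurd (h₁ _ _ _ h₄).1.1
            (not_le.2 ((Model.lt_succ_self l).trans (Model.lt_succ_self _)))
        · exact absurd (numTriple_inj.1 h₄).1 (Model.lt_succ_self _).ne'
  · rcases Model.lt_succ.1 hi with hi | rfl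
    · obtain ⟨g', c', h⟩ := h₂ i hi
      exact ⟨g', c', (hs' _).2 (.inl h)⟩
    · exact ⟨g, L, (hs' _).2 (.inr rfl)⟩

/-- An element of every set that contains `𝒢` and is closed under a composition relation `C` has
a derivation from `𝒢`. -/
theorem exists_isDerivation {𝒢 : Set M.N} (h𝒢 : 𝒢 ∈ M.sets) {b G : M.N}
    (hb : ∀ H ∈ 𝒢, H < b) {C : M.N → M.N → M.N → Prop}
    (hC : ∀ G₀ G₁ H, C G₀ G₁ H → IsRawGraph H ∧ IsComposition G₀ G₁ H)
    (hG : ∀ X ∈ M.sets, (∀ H ∈ 𝒢, H ∈ X) →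
      (∀ G₀ G₁ H, G₀ ∈ X → G₁ ∈ X → C G₀ G₁ H → H ∈ X) → G ∈ X) :
    ∃ s l, IsDerivation 𝒢 s l G := by
  obtain ⟨u₀, hu₀, hu₀'⟩ := exists_graph_bound b
  let u := max u₀ b
  -- The bound on `l` loses nothing, since `l` is the index of an entry of `s`, and it keeps the
  -- matrix `Σ⁰₀`.
  have hR := bounded_sigma1_comprehension u (θ := fun H s => BoundedBy b H ∧
    ∃ l, l < s + 1 ∧ IsDerivation 𝒢 s l H) fun hs ht =>
      .and (.boundedBy (.const b) hs) (.bex (.add ht (.const 1))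
        (.isDerivation h𝒢 (.lift ht) (.var _) (.lift hs)))
  set R : Set M.N := {H | H < u ∧ ∃ s, BoundedBy b H ∧ ∃ l, l < s + 1 ∧ IsDerivation 𝒢 s l H}
    with hRdef
  have memR : ∀ {H}, H ∈ R ↔ H < u ∧ BoundedBy b H ∧ ∃ s l, IsDerivation 𝒢 s l H := by
    intro H
    rw [hRdef]
    refine and_congr_right fun _ => ⟨?_, ?_⟩
    · rintro ⟨s, hb, l, -, h⟩
      exact ⟨hb, s, l, h⟩
    · rintro ⟨hb, s, l, h⟩
      refine ⟨s, hb, l, Model.lt_add_one_iff.2 ?_, h⟩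
      obtain ⟨g, hg⟩ := h.2.2
      exact hg.fst_le
  -- Derivations grow on the right by members of `𝒢` only, so closure of `R` under composition is
  -- not immediate. Requiring that right composition with `H` preserve `R` gives a class containing
  -- `𝒢` and, by associativity, closed under composition.
  have hX := sigma0_comprehension (P := fun H => H ∈ R ∧ ∀ K, K < u → ∀ L, L < u →
      (K ∈ R → IsComposition K H L → L ∈ R))
    (.and (.mem (.var _) hR) (.ball (.const _) (.ball (.const _) (.imp (.mem (.var _) hR)
      (.imp (.isComposition (.var _) (.var (0 : Fin 4)) (.var _)) (.mem (.var _) hR))))))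
  have hGR := (hG _ hX ?_ ?_).1
  · exact (memR.1 hGR).2.2
  · intro H hH
    refine ⟨memR.2 ⟨lt_max_of_lt_right (hb H hH), boundedBy_of_lt (hb H hH), ?_⟩,
      fun K _ L hL hKR hKL => ?_⟩
    · obtain ⟨s, hs⟩ := exists_isDerivation_of_mem hH
      exact ⟨s, 0, hs⟩
    · obtain ⟨-, hKb, s, l, hs⟩ := memR.1 hKR
      obtain ⟨s', hs'⟩ := hs.exists_append hH hKL
      exact memR.2 ⟨hL, hKL.boundedBy hKb (boundedBy_of_lt (hb H hH)), s', _, hs'⟩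
  · rintro H₁ H₂ H ⟨h₁R, h₁⟩ ⟨h₂R, h₂⟩ hH
    obtain ⟨hraw, hcomp⟩ := hC _ _ _ hH
    have hb₁ := (memR.1 h₁R).2.1
    have hb₂ := (memR.1 h₂R).2.1
    refine ⟨h₂ H₁ (memR.1 h₁R).1 H (lt_max_of_lt_left
      (hu₀ H (hcomp.boundedBy hb₁ hb₂) hraw)) h₁R hcomp, fun K hK L hL hKR hKL => ?_⟩
    obtain ⟨f, hf, hf'⟩ := hcomp.1
    obtain ⟨g, hg, hg'⟩ := hKL.2.1
    -- Rebracket `K; (H₁; H₂)` as `(K; H₁); H₂`, apply the property of `H₁`, then that of `H₂`.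
    obtain ⟨K₁, hK₁, hKK₁⟩ := hu₀' K H₁ g (memR.1 hKR).2.1 hb₁ hg (hf'.unique hg' ▸ hf)
    have hK₁u : K₁ < u := lt_max_of_lt_left hK₁
    exact h₂ K₁ hK₁u L hL (h₁ K hK K₁ hK₁u hKR hKK₁) (hKK₁.assoc hcomp hKL)

/-- The source is constant along the partial compositions. Together with `IsDerivation.tgt` this
makes consecutive copies of the derivation fit together. -/
theorem IsDerivation.src {𝒢 : Set M.N} {s l H f : M.N} (h : IsDerivation 𝒢 s l H) (hf : Src H f)
    {g c : M.N} (h0 : Mem (numTriple 0 g c) s) : Src g f := by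
  have hgc := (h.1 _ _ _ h0).2.1 rfl
  subst hgc
  have hsrc : ∃ f', Src g f' := by
    obtain ⟨g', h'⟩ := h.2.2
    rcases Model.eq_zero_or_succ l with rfl | ⟨l, rfl⟩
    · obtain ⟨-, rfl⟩ := (h.1 _ _ _ h0).2.2.1 _ _ h'
      exact ⟨f, hf⟩
    · obtain ⟨g₁, c₁, h₁⟩ := h.2.1 1 (by
        rw [add_comm]
        exact lt_add_of_pos_right 1 ((zero_le : 0 ≤ l).trans_lt (Model.lt_succ_self l)))
      obtain ⟨f', hf', -⟩ := ((h.1 _ _ _ h0).2.2.2 g₁ c₁ (by rwa [zero_add])).1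
      exact ⟨f', hf'⟩
  obtain ⟨f', hf'⟩ := hsrc
  have key : ∀ i, i < l + 1 → ∀ g c, Mem (numTriple i g c) s → Src c f' := by
    refine sigma0_induction (P := fun i => i < l + 1 → ∀ g c, Mem (numTriple i g c) s → Src c f')
      (.imp (.lt (.var _) (.const _)) (.forall_entry (.var _) (.const _)
        (.src (.var _) (.const _)))) ?_ ?_
    · intro _ g' c' h'
      obtain ⟨-, rfl⟩ := (h.1 _ _ _ h0).2.2.1 _ _ h'
      exact hf'
    · intro i ih hi g' c' h'
      have hi' : i < l + 1 := (Model.lt_succ_self i).trans hi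
      obtain ⟨g₁, c₁, h₁⟩ := h.2.1 i hi'
      obtain ⟨f₁, hf₁, hf₁'⟩ := ((h.1 _ _ _ h₁).2.2.2 _ _ h').1
      rwa [(ih hi' _ _ h₁).unique hf₁]
  obtain ⟨g', h'⟩ := h.2.2
  rwa [hf.unique (key l (Model.lt_succ_self l) _ _ h')]

theorem IsDerivation.tgt {𝒢 : Set M.N} {s l H i g c f : M.N} (h : IsDerivation 𝒢 s l H)
    (hi : Mem (numTriple i g c) s) (hf : Tgt c f) : Tgt g f := by
  rcases Model.eq_zero_or_succ i with rfl | ⟨j, rfl⟩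
  · rwa [(h.1 _ _ _ hi).2.1 rfl]
  · obtain ⟨g₁, c₁, h₁⟩ := h.2.1 j ((Model.lt_succ_self j).trans
      (Model.lt_add_one_iff.2 (h.1 _ _ _ hi).1.1))
    obtain ⟨f', hf', hf''⟩ := ((h.1 _ _ _ h₁).2.2.2 _ _ hi).2.2.1
    rwa [hf.unique hf'']

/-! ### The periodic multipath given by a derivation -/

theorem Model.exists_div_mod (n i : M.N) (hn : 0 < n) : ∃ q r, i = q * n + r ∧ r < n := by
  obtain ⟨q, r, hr, h⟩ := sigma1_induction (P := fun i q => ∃ r, r < n ∧ i = q * n + r)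
    (.bex (.const _) (.eq (.var (0 : Fin 3)) (.add (.mul (.var (1 : Fin 3)) (.const _)) (.var _))))
    ⟨0, 0, hn, by ring⟩ (fun i ⟨q, r, hr, h⟩ => by
      rcases (Model.add_one_le_iff.2 hr).lt_or_eq with hr' | rfl
      · exact ⟨q, r + 1, hr', by rw [h]; ring⟩
      · exact ⟨q + 1, 0, hn, by rw [h]; ring⟩) i
  exact ⟨q, r, h, hr⟩

theorem Model.le_of_mul_add_eq {n q r q' r' : M.N} (hr' : r' < n)
    (h : q * n + r = q' * n + r') : q ≤ q' := by
  by_contra! hq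
  have h1 : (q' + 1) * n ≤ q * n := mul_le_mul_left (Model.add_one_le_iff.2 hq) n
  have h2 : q' * n + r' < (q' + 1) * n := by
    rw [add_mul, one_mul]; gcongr
  exact absurd h (h2.trans_le (h1.trans le_self_add)).ne'

theorem Model.div_mod_unique {n q r q' r' : M.N} (hr : r < n) (hr' : r' < n)
    (h : q * n + r = q' * n + r') : q = q' ∧ r = r' := by
  obtain rfl := le_antisymm (Model.le_of_mul_add_eq hr' h) (Model.le_of_mul_add_eq hr h.symm)
  exact ⟨rfl, add_left_cancel h⟩

/-- `g` is the graph at position `i` of the periodic repetition of the sequence `g₀, …, g_l`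
coded by `s`. -/
def PeriodicAt (s l i g : M.N) : Prop :=
  ∃ q r, i = q * (l + 1) + r ∧ r < l + 1 ∧ ∃ c, Mem (numTriple r g c) s

/-- The graph of the function given by `PeriodicAt`. -/
def periodicPath (s l : M.N) : Set M.N := {p | ∃ i g, p = numPair i g ∧ PeriodicAt s l i g}

theorem numPair_mem_periodicPath {s l i g : M.N} :
    numPair i g ∈ periodicPath s l ↔ PeriodicAt s l i g := by
  refine ⟨?_, fun h => ⟨i, g, rfl, h⟩⟩
  rintro ⟨i', g', h, h'⟩
  obtain ⟨rfl, rfl⟩ := numPair_inj.1 h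
  exact h'

theorem periodicPath_mem_sets (s l : M.N) : periodicPath s l ∈ M.sets := by
  refine sigma0_comprehension (.exists_of_le (.var 0) (fun _ _ ⟨_, h⟩ => h.1 ▸ left_le_numPair _ _)
    (.exists_of_le (.var (0 : Fin 3)) 
      (fun _ _ h => (right_le_numPair _ _).trans_eq h.1.symm)
    (.and (.eq (.var (0 : Fin 4)) (.numPair (.var _) (.var _)))
    (.exists_of_le (.var (2 : Fin 4)) ?_ (.exists_of_le (.var (2 : Fin 5)) ?_
      (.and (.eq (.var (2 : Fin 6)) (.add (.mul (.var _) (.const _)) (.var _)))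
      (.and (.lt (.var _) (.const _)) (.exists_of_le (.const s) (fun _ _ h => h.trd_le)
      (.memCode (.numTriple (.var (5 : Fin 7)) (.var (3 : Fin 7)) (.var _)) (.const _))))))))))
  · rintro x q ⟨r, h, -⟩
    show q ≤ x 2
    rw [show x 2 = _ from h]
    exact (le_mul_of_one_le_right zero_le le_add_self).trans le_self_add
  · rintro x r ⟨h, -⟩
    show r ≤ x 2
    rw [show x 2 = _ from h]
    exact le_add_self

section

variable {𝒢 : Set M.N} {s l G : M.N} (h : IsDerivation 𝒢 s l G)
include h

theorem IsDerivation.exists_periodicAt (i : M.N) : ∃ g, PeriodicAt s l i g := by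
  obtain ⟨q, r, hi, hr⟩ := Model.exists_div_mod (l + 1) i
    ((zero_le : 0 ≤ l).trans_lt (Model.lt_succ_self l))
  obtain ⟨g, c, hg⟩ := h.2.1 r hr
  exact ⟨g, q, r, hi, hr, c, hg⟩

theorem IsDerivation.periodicAt_unique {i g g' : M.N} (hg : PeriodicAt s l i g)
    (hg' : PeriodicAt s l i g') : g = g' := by
  obtain ⟨q, r, rfl, hr, c, hc⟩ := hg
  obtain ⟨q', r', hi, hr', c', hc'⟩ := hg'
  obtain ⟨-, rfl⟩ := Model.div_mod_unique hr hr' hi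
  exact ((h.1 _ _ _ hc').2.2.1 _ _ hc).1

theorem IsDerivation.mem_of_periodicAt {i g : M.N} (hg : PeriodicAt s l i g) : g ∈ 𝒢 := by
  obtain ⟨q, r, rfl, hr, c, hc⟩ := hg
  exact (h.1 _ _ _ hc).1.2

theorem IsDerivation.eq_of_mem_last {g c : M.N} (hc : Mem (numTriple l g c) s) : c = G := by
  obtain ⟨g', hg'⟩ := h.2.2
  exact ((h.1 _ _ _ hg').2.2.1 _ _ hc).2

theorem IsDerivation.tgt_src_of_periodicAt (hG : IsComposition G G G) {i g g' : M.N}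
    (hg : PeriodicAt s l i g) (hg' : PeriodicAt s l (i + 1) g') : ∃ f, Tgt g f ∧ Src g' f := by
  obtain ⟨q, r, rfl, hr, c, hc⟩ := hg
  obtain ⟨q', r', hi, hr', c', hc'⟩ := hg'
  rcases (Model.lt_add_one_iff.1 hr).lt_or_eq with hrl | rfl
  · obtain ⟨-, rfl⟩ := Model.div_mod_unique (q := q) (r := r + 1) (add_lt_add_left hrl 1) hr'
      (by rw [← hi]; ring)
    obtain ⟨-, ⟨f, hf, hf'⟩, -⟩ := (h.1 _ _ _ hc).2.2.2 _ _ hc'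
    exact ⟨f, h.tgt hc hf, hf'⟩
  -- At the end of a period the next graph is `g₀`; idempotence of `G` makes the target of the last
  -- graph the source of the first.
  · obtain ⟨-, rfl⟩ := Model.div_mod_unique (q := q + 1) (r := 0)
      ((zero_le : 0 ≤ r).trans_lt hr) hr' (by rw [← hi]; ring)
    obtain rfl := h.eq_of_mem_last hc
    obtain ⟨f, hf, hf'⟩ := hG.2.1
    exact ⟨f, h.tgt hc hf, h.src hf' hc'⟩

/-- Along a descending thread through the periodic multipath, from any multiple of the period one
reaches, by a strict arc of the composed graph, another multiple of the period. -/
theorem IsDerivation.exists_strict_arc (hG : IsComposition G G G) {t : M.N} {T : Set M.N}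
    (hT : T ∈ M.sets) (hT₁ : ∀ i, ∃ y, numPair i y ∈ T)
    (hT₂ : ∀ i y z, numPair i y ∈ T → numPair i z ∈ T → y = z)
    (harc : ∀ i g x y, PeriodicAt s l (t + i) g → numPair i x ∈ T → numPair (i + 1) y ∈ T →
      AnyArc g x y)
    (hstrict : ∀ k, ∃ i g x y, k ≤ i ∧ PeriodicAt s l (t + i) g ∧ numPair i x ∈ T ∧
      numPair (i + 1) y ∈ T ∧ Arc g x 0 y)
    {x d q : M.N} (hx : numPair d x ∈ T) (hq : q * (l + 1) = t + d) :
    ∃ z e q', numPair e z ∈ T ∧ q' * (l + 1) = t + e ∧ Arc G x 0 z := by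
  obtain ⟨i₀, g₀, x₀, y₀, hi₀, hg₀, hx₀, hy₀, ha₀⟩ := hstrict d
  obtain ⟨m₀, rfl⟩ := exists_add_of_le hi₀
  have hstr : ∀ g x y, PeriodicAt s l (t + (d + m₀)) g → numPair (d + m₀) x ∈ T →
      numPair (d + m₀ + 1) y ∈ T → Arc g x 0 y := by
    intro g x y hg hx hy
    rwa [h.periodicAt_unique hg hg₀, hT₂ _ _ _ hx hx₀, hT₂ _ _ _ hy hy₀]
  have hany : ∀ {x y z}, AnyArc G x y → AnyArc G y z → AnyArc G x z := fun h₁ h₂ =>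
    (hG.2.2.2 _ _).2.2 ⟨_, h₁, h₂⟩
  -- Here `w` plays the thread value at the start of the current period, `z` the value after `m + 1`
  -- steps, and `c` the partial composition `c_r`. From offset `m₀` on, a strict arc has been met,
  -- either in a completed period or in the current one. The alternative `w = x` covers the first
  -- period, where no identity graph is available.
  have key : ∀ m, ∃ q' r g c w z, m = q' * (l + 1) + r ∧ r < l + 1 ∧ Mem (numTriple r g c) s ∧
      (w = x ∨ AnyArc G x w) ∧ numPair (d + m + 1) z ∈ T ∧ AnyArc c w z ∧
      (m₀ ≤ m → Arc G x 0 w ∨ Arc c w 0 z) := by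
    refine sigma0_induction ?_ ?_ ?_
    · refine .exists_of_le (.var 0) ?_ (.exists_of_le (.var (0 : Fin 3)) ?_
        (.exists_of_le (.const s) ?_ (.exists_of_le (.const s) ?_ (.exists_of_le
        (.var (5 : Fin 6)) ?_ (.exists_of_le (.var (5 : Fin 7)) ?_
        (.and (.eq (.var (0 : Fin 8)) (.add (.mul (.var (2 : Fin 8)) (.const _))
          (.var (3 : Fin 8))))
        (.and (.lt (.var (3 : Fin 8)) (.const _))
        (.and (.memCode (.numTriple (.var (3 : Fin 8)) (.var (4 : Fin 8)) (.var (5 : Fin 8)))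
          (.const _))
        (.and (.or (.eq (.var (6 : Fin 8)) (.const _)) (.anyArc (.const _) (.const _) (.var _)))
        (.and (.mem (.numPair (.add (.add (.const _) (.var (0 : Fin 8))) (.const _))
          (.var (7 : Fin 8))) hT)
        (.and (.anyArc (.var (5 : Fin 8)) (.var (6 : Fin 8)) (.var (7 : Fin 8)))
        (.imp (.le (.const _) (.var (0 : Fin 8)))
          (.or (.arc (.const _) (.const _) (.const _) (.var (6 : Fin 8)))
            (.arc (.var (5 : Fin 8)) (.var (6 : Fin 8)) (.const _) (.var (7 : Fin 8))))))))))))))))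
      · rintro y q' ⟨r, g, c, w, z, h, -⟩
        rw [h]; exact (le_mul_of_one_le_right zero_le le_add_self).trans le_self_add
      · rintro y r ⟨g, c, w, z, h, -⟩
        show r ≤ y 0
        rw [show y 0 = _ from h]; exact le_add_self
      · rintro y g ⟨c, w, z, -, -, h, -⟩
        exact h.snd_le
      · rintro y c ⟨w, z, -, -, h, -⟩
        exact h.trd_le
      · rintro y w ⟨z, -, -, -, -, -, h, -⟩
        exact h.left_lt.le
      · rintro y z ⟨-, -, -, -, -, h, -⟩
        exact h.right_lt.le
    · obtain ⟨g, c, hg⟩ := h.2.1 0 ((zero_le : 0 ≤ l).trans_lt (Model.lt_succ_self l))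
      have hgc := (h.1 _ _ _ hg).2.1 rfl
      subst hgc
      obtain ⟨z, hz⟩ := hT₁ (d + 1)
      have hp : PeriodicAt s l (t + d) g :=
        ⟨q, 0, by rw [hq, add_zero], (zero_le : 0 ≤ l).trans_lt (Model.lt_succ_self l), _, hg⟩
      refine ⟨0, 0, g, g, x, z, by ring, (zero_le : 0 ≤ l).trans_lt (Model.lt_succ_self l), hg,
        .inl rfl, by rwa [add_zero], harc d g x z hp hx hz, fun hm => .inr ?_⟩
      obtain rfl := le_antisymm hm zero_le
      exact hstr g x z (by rwa [add_zero]) (by rwa [add_zero]) (by rwa [add_zero])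
    · rintro m ⟨q', r, g, c, w, z, rfl, hr, hc, hw, hz, hwz, hm⟩
      obtain ⟨z', hz'⟩ := hT₁ (d + (q' * (l + 1) + r + 1) + 1)
      have hz₁ : numPair (d + (q' * (l + 1) + r + 1)) z ∈ T := by rwa [← add_assoc]
      rcases (Model.lt_add_one_iff.1 hr).lt_or_eq with hrl | rfl
      · have hr1 : r + 1 < l + 1 := add_lt_add_left hrl 1
        obtain ⟨g', c', hc'⟩ := h.2.1 (r + 1) hr1
        have hp : PeriodicAt s l (t + (d + (q' * (l + 1) + r + 1))) g' :=
          ⟨q + q', r + 1, by rw [← add_assoc, ← hq]; ring, hr1, c', hc'⟩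
        have hcomp := ((h.1 _ _ _ hc).2.2.2 _ _ hc').2.2.2
        have hzz' := harc _ _ _ _ hp hz₁ hz'
        refine ⟨q', r + 1, g', c', w, z', by ring, hr1, hc', hw, hz',
          (hcomp w z').2.2 ⟨z, hwz, hzz'⟩, fun hm' => ?_⟩
        rcases hm'.lt_or_eq with hm' | rfl
        · exact (hm (Model.lt_add_one_iff.1 hm')).imp id fun h' =>
            (hcomp w z').1.2 ⟨z, .inl ⟨h', hzz'⟩⟩
        · exact .inr ((hcomp w z').1.2 ⟨z, .inr ⟨hwz, hstr _ _ _ hp hz₁ hz'⟩⟩)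
      · obtain rfl := h.eq_of_mem_last hc
        have h0 : 0 < r + 1 := (zero_le : 0 ≤ r).trans_lt hr
        obtain ⟨g', c', hc'⟩ := h.2.1 0 h0
        have hgc := (h.1 _ _ _ hc').2.1 rfl
        subst hgc
        have hp : PeriodicAt s r (t + (d + (q' * (r + 1) + r + 1))) g' :=
          ⟨q + q' + 1, 0, by rw [← add_assoc, ← hq]; ring, h0, _, hc'⟩
        refine ⟨q' + 1, 0, g', g', z, z', by ring, h0, hc', .inr ?_, hz',
          harc _ _ _ _ hp hz₁ hz', fun hm' => ?_⟩
        · rcases hw with rfl | hw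
          · exact hwz
          · exact hany hw hwz
        · rcases hm'.lt_or_eq with hm' | rfl
          · refine .inl ?_
            rcases hm (Model.lt_add_one_iff.1 hm') with h' | h'
            · exact (hG.2.2.2 _ _).1.2 ⟨w, .inl ⟨h', hwz⟩⟩
            · rcases hw with rfl | hw
              · exact h'
              · exact (hG.2.2.2 _ _).1.2 ⟨w, .inr ⟨hw, h'⟩⟩
          · exact .inr (hstr _ _ _ hp hz₁ hz')
  -- This offset is at least `m₀` and ends a period, so the partial composition there is `G` itself.
  obtain ⟨q', r, g, c, w, z, hm, hr, hc, hw, hz, hwz, hs⟩ := key (m₀ * (l + 1) + l)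
  obtain ⟨rfl, rfl⟩ := Model.div_mod_unique (Model.lt_succ_self l) hr hm
  obtain rfl := h.eq_of_mem_last hc
  refine ⟨z, _, q + m₀ + 1, hz, ?_, ?_⟩
  · rw [add_mul, add_mul, hq]; ring
  · rcases hs ((le_mul_of_one_le_right zero_le le_add_self).trans le_self_add) with h' | h'
    · exact (hG.2.2.2 _ _).1.2 ⟨w, .inl ⟨h', hwz⟩⟩
    · rcases hw with rfl | hw
      · exact h'
      · exact (hG.2.2.2 _ _).1.2 ⟨w, .inr ⟨hw, h'⟩⟩

theorem IsDerivation.exists_strict_loop (hG : IsComposition G G G) {t : M.N} {T : Set M.N}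
    (hT : T ∈ M.sets) (hT₁ : ∀ i, ∃ y, numPair i y ∈ T)
    (hT₂ : ∀ i y z, numPair i y ∈ T → numPair i z ∈ T → y = z)
    (harc : ∀ i g x y, PeriodicAt s l (t + i) g → numPair i x ∈ T → numPair (i + 1) y ∈ T →
      AnyArc g x y)
    (hstrict : ∀ k, ∃ i g x y, k ≤ i ∧ PeriodicAt s l (t + i) g ∧ numPair i x ∈ T ∧
      numPair (i + 1) y ∈ T ∧ Arc g x 0 y) : ∃ x, Arc G x 0 x := by
  by_contra! hirr
  -- The class consists of the thread values at multiples of the period, ordered by strict arcs of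
  -- `G`. Each such value is below `G` because an arc of `G` leaves it.
  obtain ⟨x, ⟨d, hx, q, -, hq⟩, hmax⟩ := exists_maximal_of_bounded G
    (A := fun x d => numPair d x ∈ T ∧ ∃ q, q < t + d + 1 ∧ q * (l + 1) = t + d)
    (S := fun x y => Arc G x 0 y)
    (fun hs ht => .and (.mem (.numPair ht hs) hT) (.bex (.add (.add (.const t) ht) (.const 1))
      (.eq (.mul (.var _) (.const _)) (.add (.const _) (.lift ht)))))
    (fun hs ht => .arc (.const G) hs (.const 0) ht)
    (fun x d ⟨hx, q, _, hq⟩ => by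
      obtain ⟨z, e, q', -, -, hz⟩ := h.exists_strict_arc hG hT hT₁ hT₂ harc hstrict hx hq
      exact hz.left_lt)
    (by
      -- The thread starts at position `t`, and `t * (l + 1)` is a multiple of the period not before
      -- it.
      obtain ⟨d, hd⟩ := exists_add_of_le
        (le_mul_of_one_le_right zero_le le_add_self : t ≤ t * (l + 1))
      obtain ⟨x, hx⟩ := hT₁ d
      exact ⟨x, d, hx, t, Model.lt_add_one_iff.2 le_self_add, hd⟩)
    hirr (fun x y z hxy hyz => (hG.2.2.2 _ _).1.2 ⟨y, .inl ⟨hxy, .inl hyz⟩⟩)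
  obtain ⟨z, e, q', hz, hq', hxz⟩ := h.exists_strict_arc hG hT hT₁ hT₂ harc hstrict hx hq
  exact hmax z e ⟨hz, q', Model.lt_add_one_iff.2 (by
    rw [← hq']; exact le_mul_of_one_le_right zero_le le_add_self), hq'⟩ hxz

end

variable {n m : ℕ} {v : Fin n → M.N} {W : Fin m → M.sets}

/-! ### Interpretation of the formulas -/

theorem sat_memCode {i c : Term n} :
    (memCode i c : Fml n m).Sat M v W ↔ Mem (i.eval M v) (c.eval M v) := by
  simp only [memCode, ex, dvd, triple, pair, Fml.Sat, Term.eval, Term.eval_lift, Fin.snoc_last]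
  rfl

theorem sat_source {G f : Term n} :
    (source G f : Fml n m).Sat M v W ↔ Src (G.eval M v) (f.eval M v) := by
  simp only [source, ex, triple, pair, Fml.Sat, Term.eval, Term.eval_lift, Fin.snoc_last]
  rfl

theorem sat_target {G f : Term n} :
    (target G f : Fml n m).Sat M v W ↔ Tgt (G.eval M v) (f.eval M v) := by
  simp only [target, ex, triple, pair, Fml.Sat, Term.eval, Term.eval_lift, Fin.snoc_last]
  rfl

theorem sat_arc {G x r y : Term n} : (arc G x r y : Fml n m).Sat M v W ↔
    Arc (G.eval M v) (x.eval M v) (r.eval M v) (y.eval M v) := by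
  simp only [arc, ex, sat_memCode, triple, pair, Fml.Sat, Term.eval, Term.eval_lift, Fin.snoc_last]
  rfl

theorem sat_anyArc {G x y : Term n} : (anyArc G x y : Fml n m).Sat M v W ↔
    AnyArc (G.eval M v) (x.eval M v) (y.eval M v) :=
  or_congr sat_arc sat_arc

theorem sat_isCode {c : Term n} : (isCode c : Fml n m).Sat M v W ↔ IsCode (c.eval M v) := by
  simp only [isCode, sameCode, Fml.iff, ex, all, sat_memCode, triple, pair, Fml.Sat, Term.eval,
    Term.eval_lift, Fin.snoc_last, ← iff_iff_implies_and_implies]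
  rfl

/-- `x` is a parameter of `f`. -/
def InVar (V : Set M.N) (f x : M.N) : Prop := ∃ c, numPair f c ∈ V ∧ Mem x c

theorem sat_inVar {V : Fin m} {f x : Term n} :
    (inVar V f x : Fml n m).Sat M v W ↔ InVar (W V : Set M.N) (f.eval M v) (x.eval M v) := by
  simp only [inVar, app, ex, sat_memCode, pair, Fml.Sat, Term.eval, Term.eval_lift, Fin.snoc_last]
  rfl

/-- `G` is a size-change graph. -/
def IsGraph (V : Set M.N) (G : M.N) : Prop :=
  (∃ f g e, G = numTriple f g e ∧ IsCode e ∧ ∀ p, Mem p e → ∃ x r y, p = numTriple x r y ∧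
    InVar V f x ∧ (r = 0 ∨ r = 1) ∧ InVar V g y) ∧
  ∀ x y, ¬ (Arc G x 0 y ∧ Arc G x 1 y)

theorem sat_isGraph {V : Fin m} {G : Term n} :
    (isGraph V G : Fml n m).Sat M v W ↔ IsGraph (W V : Set M.N) (G.eval M v) := by
  simp only [isGraph, isLabel, down, Down, ex, all, sat_memCode, sat_isCode, sat_inVar, sat_arc,
    triple, pair, Fml.Sat, Term.eval, Term.eval_lift, Fin.snoc_last]
  rfl

/-- `H` is the composition `G₀; G₁`. -/
def IsComp (V : Set M.N) (G₀ G₁ H : M.N) : Prop :=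
  IsGraph V G₀ ∧ IsGraph V G₁ ∧ IsGraph V H ∧ ∃ f g h, Src G₀ f ∧ Tgt G₀ g ∧ Src G₁ g ∧ Tgt G₁ h ∧
    Src H f ∧ Tgt H h ∧ ∀ x z,
      (Arc H x 0 z ↔ ∃ y, InVar V g y ∧ ∃ r, (r = 0 ∨ r = 1) ∧
        ((Arc G₀ x 0 y ∧ Arc G₁ y r z) ∨ (Arc G₀ x r y ∧ Arc G₁ y 0 z))) ∧
      (Arc H x 1 z ↔ (∃ y, InVar V g y ∧ Arc G₀ x 1 y ∧ Arc G₁ y 1 z) ∧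
        ∀ y, InVar V g y → ∀ r s, (r = 0 ∨ r = 1) → (s = 0 ∨ s = 1) →
          Arc G₀ x r y ∧ Arc G₁ y s z → r = 1 ∧ s = 1)

theorem sat_isComp {V : Fin m} {G₀ G₁ H : Term n} : (isComp V G₀ G₁ H : Fml n m).Sat M v W ↔
    IsComp (W V : Set M.N) (G₀.eval M v) (G₁.eval M v) (H.eval M v) := by
  simp only [isComp, isLabel, down, Down, Fml.iff, ex, all, sat_isGraph, sat_source, sat_target,
    sat_inVar, sat_arc, Fml.Sat, Term.eval, Term.eval_lift, Fin.snoc_last,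
    ← iff_iff_implies_and_implies]
  rfl

theorem IsGraph.isRawGraph {V : Set M.N} {G : M.N} : IsGraph V G → IsRawGraph G := by
  rintro ⟨⟨f, g, e, hG, he, h⟩, -⟩
  refine ⟨f, g, e, hG, he, fun p hp => ?_⟩
  obtain ⟨x, r, y, hp, -, hr, -⟩ := h p hp
  exact ⟨x, r, y, hp, hr⟩

theorem IsGraph.inVar_of_arc {V : Set M.N} {G g x r y : M.N} (hG : IsGraph V G) (hg : Tgt G g)
    (h : Arc G x r y) : InVar V g y := by
  obtain ⟨⟨f, g', e, rfl, -, he⟩, -⟩ := hG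
  obtain rfl := hg.unique ⟨f, e, rfl⟩
  obtain ⟨x', r', y', hp, -, -, hy⟩ := he _ (arc_numTriple.1 h)
  rwa [(numTriple_inj.1 hp).2.2]

/-- The restriction of the middle parameter to `Var(g)` is automatic for arcs of a graph. A composed
path without any strict alternative yields the non-strict arc, so arcs of either label match all
composed paths. -/
theorem IsComp.isComposition {V : Set M.N} {G₀ G₁ H : M.N} (hc : IsComp V G₀ G₁ H) :
    IsComposition G₀ G₁ H := by
  obtain ⟨hG₀, hG₁, -, f, g, h, hf, hg, hg', hh, hf', hh', harc⟩ := hc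
  have hs : ∀ x z, Arc H x 0 z ↔ StrictStep G₀ G₁ x z := by
    intro x z
    rw [(harc x z).1]
    constructor
    · rintro ⟨y, -, r, rfl | rfl, ⟨h₁, h₂⟩ | ⟨h₁, h₂⟩⟩
      · exact ⟨y, .inl ⟨h₁, .inl h₂⟩⟩
      · exact ⟨y, .inl ⟨h₁, .inl h₂⟩⟩
      · exact ⟨y, .inl ⟨h₁, .inr h₂⟩⟩
      · exact ⟨y, .inr ⟨.inr h₁, h₂⟩⟩
    · rintro ⟨y, ⟨h₁, h₂ | h₂⟩ | ⟨h₁ | h₁, h₂⟩⟩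
      · exact ⟨y, hG₀.inVar_of_arc hg h₁, 0, .inl rfl, .inl ⟨h₁, h₂⟩⟩
      · exact ⟨y, hG₀.inVar_of_arc hg h₁, 1, .inr rfl, .inl ⟨h₁, h₂⟩⟩
      · exact ⟨y, hG₀.inVar_of_arc hg h₁, 0, .inl rfl, .inr ⟨h₁, h₂⟩⟩
      · exact ⟨y, hG₀.inVar_of_arc hg h₁, 1, .inr rfl, .inr ⟨h₁, h₂⟩⟩
  refine ⟨⟨f, hf, hf'⟩, ⟨g, hg, hg'⟩, ⟨h, hh, hh'⟩, fun x z => ⟨hs x z, ?_, ?_⟩⟩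
  · rintro (h | h)
    · exact ((hs x z).1 h).anyStep
    · obtain ⟨⟨y, -, h₁, h₂⟩, -⟩ := (harc x z).2.1 h
      exact ⟨y, .inr h₁, .inr h₂⟩
  · rintro ⟨y, h₁, h₂⟩
    by_cases hst : StrictStep G₀ G₁ x z
    · exact .inl ((hs x z).2 hst)
    · have hns : ∀ {y r s}, (r = 0 ∨ r = 1) → (s = 0 ∨ s = 1) → Arc G₀ x r y ∧ Arc G₁ y s z →
          r = 1 ∧ s = 1 := by
        rintro y r s (rfl | rfl) (rfl | rfl) ⟨h₁, h₂⟩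
        · exact (hst ⟨y, .inl ⟨h₁, .inl h₂⟩⟩).elim
        · exact (hst ⟨y, .inl ⟨h₁, .inr h₂⟩⟩).elim
        · exact (hst ⟨y, .inr ⟨.inr h₁, h₂⟩⟩).elim
        · exact ⟨rfl, rfl⟩
      refine .inr ((harc x z).2.2 ⟨⟨y, ?_⟩, fun y _ r s hr hs => hns hr hs⟩)
      rcases h₁ with h₁ | h₁
      · exact (hst ⟨y, .inl ⟨h₁, h₂⟩⟩).elim
      · rcases h₂ with h₂ | h₂
        · exact (hst ⟨y, .inr ⟨.inr h₁, h₂⟩⟩).elim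
        · exact ⟨hG₀.inVar_of_arc hg h₁, h₁, h₂⟩

/-- `F` is the graph of a function. -/
def IsFun (F : Set M.N) : Prop :=
  (∀ p, p ∈ F → ∃ i y, p = numPair i y) ∧ (∀ i, ∃ y, numPair i y ∈ F) ∧
    ∀ i y z, numPair i y ∈ F ∧ numPair i z ∈ F → y = z

theorem sat_isFun {F : Fin m} : (isFun F : Fml n m).Sat M v W ↔ IsFun (W F : Set M.N) := by
  simp only [isFun, ex, all, pair, Fml.Sat, Term.eval, Term.eval_lift, Fin.snoc_last]
  rfl

theorem sat_isMultipath {𝒢 P : Fin m} : (isMultipath 𝒢 P : Fml n m).Sat M v W ↔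
    IsFun (W P : Set M.N) ∧ (∀ i G, numPair i G ∈ (W P : Set M.N) → G ∈ (W 𝒢 : Set M.N)) ∧
    ∀ i G H, numPair i G ∈ (W P : Set M.N) ∧ numPair (i + 1) H ∈ (W P : Set M.N) →
      ∃ g, Tgt G g ∧ Src H g := by
  simp only [isMultipath, app, sat_isFun, sat_source, sat_target, ex, all, pair, Fml.Sat, Term.eval,
    Term.eval_lift, Fin.snoc_last]
  rfl

theorem sat_infiniteDescent {P : Fin m} : (infiniteDescent P : Fml n m).Sat M v W ↔
    ∃ t, ∃ T : M.sets, IsFun (T : Set M.N) ∧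
      (∀ i G x y, numPair (t + i) G ∈ (W P : Set M.N) ∧ numPair i x ∈ (T : Set M.N) ∧
        numPair (i + 1) y ∈ (T : Set M.N) → AnyArc G x y) ∧
      ∀ k, ∃ i G x y, ¬ i < k ∧ numPair (t + i) G ∈ (W P : Set M.N) ∧
        numPair i x ∈ (T : Set M.N) ∧ numPair (i + 1) y ∈ (T : Set M.N) ∧ Arc G x 0 y := by
  simp only [infiniteDescent, app, down, sat_isFun, sat_arc, sat_anyArc, ex, exSet, all, pair,
    Fml.Sat, Term.eval, Term.eval_lift, Fin.snoc_last, Fin.snoc_castSucc]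
  rfl

theorem sat_inCl {V 𝒢 : Fin m} {G : Term n} : (inCl V 𝒢 G : Fml n m).Sat M v W ↔
    ∀ X : M.sets, ((∀ H, H ∈ (W 𝒢 : Set M.N) → H ∈ (X : Set M.N)) ∧
      ∀ G₀ G₁ H, G₀ ∈ (X : Set M.N) ∧ G₁ ∈ (X : Set M.N) ∧ IsComp (W V : Set M.N) G₀ G₁ H →
        H ∈ (X : Set M.N)) → G.eval M v ∈ (X : Set M.N) := by
  simp only [inCl, sat_isComp, allSet, all, Fml.Sat, Term.eval, Term.eval_lift, Fin.snoc_last,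
    Fin.snoc_castSucc]

/-! ### The criterion in a model -/

theorem sat_sctCriterionForward (v : Fin 0 → M.N) (W : Fin 0 → M.sets) :
    sctCriterionForward.Sat M v W := by
  intro V 𝒢
  simp only [isFiniteGraphSet, isIdempotent, ex, all, allSet, down, sat_isGraph, sat_isComp,
    sat_isMultipath, sat_infiniteDescent, sat_inCl, sat_arc, Fml.Sat, Term.eval, Term.eval_lift,
    Fin.snoc_last, Fin.snoc_castSucc]
  rintro ⟨-, ⟨b, hb⟩, -⟩ hdesc G ⟨hcl, hidem⟩
  have hG := hidem.isComposition
  obtain ⟨s, l, h⟩ := exists_isDerivation 𝒢.2 hb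
    (fun _ _ _ hc => ⟨hc.2.2.1.isRawGraph, hc.isComposition⟩)
    fun X hX h₀ h₁ => hcl ⟨X, hX⟩ ⟨h₀, fun G₀ G₁ H h => h₁ G₀ G₁ H h.1 h.2.1 h.2.2⟩
  -- The descent hypothesis is applied to one multipath only, the periodic repetition of the
  -- derivation of `G`.
  obtain ⟨t, T, hT, harc, hstrict⟩ := hdesc ⟨_, periodicPath_mem_sets s l⟩ <| by
    simp only [IsFun, numPair_mem_periodicPath]
    refine ⟨⟨fun p ⟨i, g, hp, _⟩ => ⟨i, g, hp⟩, h.exists_periodicAt,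
      fun i y z hyz => h.periodicAt_unique hyz.1 hyz.2⟩, fun i g => h.mem_of_periodicAt,
      fun i g g' hg => h.tgt_src_of_periodicAt hG hg.1 hg.2⟩
  simp only [numPair_mem_periodicPath, not_lt] at harc hstrict
  exact h.exists_strict_loop hG T.2 hT.2.1 (fun i y z hy hz => hT.2.2 i y z ⟨hy, hz⟩)
    (fun i g x y h₁ h₂ h₃ => harc i g x y ⟨h₁, h₂, h₃⟩) hstrict

end SOA

theorem mainTheorem6 : SOA.RCA0Proves.{u} SOA.sctCriterionForward := by
  intro M hM
  have : Fact M.IsModelRCA0 := ⟨hM⟩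
  exact SOA.sat_sctCriterionForward _ _
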